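/- Let $d,n\ge 0$ be integers, let $A_1,\dots,A_n:\mathbb R^d\rightrightarrows\mathbb R^d$ be maximal monotone, and let $B:\mathbb R^d\to\mathbb R^d$ be monotone and $L$-Lipschitz. Assume that the inclusion $$0\in\sum_{i=1}^n A_i(z)+B(z)\qquad(*)$$ has at least one solution. Stochastic Projective Splitting takes $\tau>0$, deterministic stepsizes $\alpha_k,\rho_k\ge 0$ and an initial point $p^1=(z^1,w_1^1,\dots,w_{n+1}^1)\in(\mathbb R^d)^{n+2}$ (possibly random) with $\sum_{i=1}^{n+1}w_i^1=0$, and for $k=1,2,\dots$ computes, with $J_{\tau A_i}=(I+\tau A_i)^{-1}$, $$t_i^k=z^k+\tau w_i^k,\quad x_i^k=J_{\tau A_i}(t_i^k),\quad y_i^k=\tau^{-1}(t_i^k-x_i^k)\qquad(i=1,\dots,n),$$ $$r^k=B(z^k)+\epsilon^k,\quad x_{n+1}^k=z^k-\rho_k(r^k-w_{n+1}^k),\quad y_{n+1}^k=B(x_{n+1}^k)+e^k,$$ $$z^{k+1}=z^k-\alpha_k\sum_{i=1}^{n+1}y_i^k,\qquad w_i^{k+1}=w_i^k-\alpha_k\Big(x_i^k-\frac1{n+1}\sum_{j=1}^{n+1}x_j^k\Big)\quad(i=1,\dots,n+1),$$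 where the noise terms $\epsilon^k,e^k$ are integrable $\mathbb R^d$-valued random variables on a probability space. Write $p^k=(z^k,w_1^k,\dots,w_{n+1}^k)$, $\mathcal F_k=\sigma(p^1,\dots,p^k)$ and $\mathcal E_k=\sigma(\epsilon^k)$, and suppose that there are constants $N_1,N_2,N_3,N_4\in[0,\infty)$ such that, for every $k$, almost surely, $$\mathbb E[\epsilon^k\mid\mathcal F_k]=0,\qquad \mathbb E[e^k\mid\mathcal F_k]=0,$$ $$\mathbb E[\|\epsilon^k\|^2\mid\mathcal F_k]\le N_1+N_2\|B(z^k)\|^2,\qquad \mathbb E[\|e^k\|^2\mid\mathcal F_k,\mathcal E_k]\le N_3+N_4\|B(x_{n+1}^k)\|^2.$$ Suppose moreover that $$\sum_k\alpha_k\rho_k=\infty,\qquad \sum_k\alpha_k^2<\infty,\qquad \sum_k\alpha_k\rho_k^2<\infty,\qquad \rho_k\le\overline\rho\ \text{ for all }k,\quad \overline\rho<\frac1L$$ (where $1/L=\infty$ if $L=0$). Then, with probability one, $z^k$ converges to a (random) solution $z^*$ of $(*)$; and, with probability one, $p^k$ converges to a (random) point of the extended solution set $$\mathcal S=\Big\{(z,w_1,\dots,w_{n+1})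 : w_i\in A_i(z)\ (i=1,\dots,n),\ w_{n+1}=B(z),\ \sum_{i=1}^{n+1}w_i=0\Big\}.$$ -/

import Mathlib

open MeasureTheory ProbabilityTheory Filter Topology
open scoped Pointwise ENNReal NNReal

namespace SPS

/-- The Euclidean space `ℝ^d`. -/
abbrev Vec (d : ℕ) : Type := EuclideanSpace ℝ (Fin d)

/-- A point-to-set map `A` on `ℝ^d` is a monotone operator. -/
def IsMonotoneOp {d : ℕ} (A : Vec d → Set (Vec d)) : Prop :=
  ∀ ⦃x y u v : Vec d⦄, u ∈ A x → v ∈ A y → 0 ≤ inner ℝ (u - v) (x - y)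

/-- A monotone operator is maximal if no other monotone operator has a graph containing its
graph. -/
def IsMaximalMonotone {d : ℕ} (A : Vec d → Set (Vec d)) : Prop :=
  IsMonotoneOp A ∧
    ∀ A' : Vec d → Set (Vec d), IsMonotoneOp A' → (∀ x, A x ⊆ A' x) → A' = A

/-- The value at `t` of the resolvent `(I + τ A)⁻¹`, as a set. For `A` maximal monotone and
`0 < τ` it is a single point. -/
def resolventOp {d : ℕ} (τ : ℝ) (A : Vec d → Set (Vec d)) (t : Vec d) : Set (Vec d) :=
  {x | t ∈ {x} + τ • A x}

/-- `z` solves the inclusion `0 ∈ ∑ i, A i z + B z`. -/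
def IsSolution {d n : ℕ} (A : Fin n → Vec d → Set (Vec d)) (B : Vec d → Vec d) (z : Vec d) :
    Prop :=
  (0 : Vec d) ∈ (∑ i, A i z) + {B z}

/-- The extended solution set. The dual vectors `w_1, …, w_n` are `w i.castSucc` for `i : Fin n`,
and `w_{n+1}` is `w (Fin.last n)`. -/
def extendedSolutionSet {d n : ℕ} (A : Fin n → Vec d → Set (Vec d)) (B : Vec d → Vec d) :
    Set (Vec d × (Fin (n + 1) → Vec d)) :=
  {p | (∀ i : Fin n, p.2 i.castSucc ∈ A i p.1) ∧ p.2 (Fin.last n) = B p.1 ∧ ∑ i, p.2 i = 0}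

/-- The sequences `z, w, x, y` are produced by stochastic projective splitting with resolvent
stepsize `τ`, stepsizes `α, ρ` and noise values `ε, e`. The first iteration has index `0`. -/
structure IsRun {d n : ℕ} (A : Fin n → Vec d → Set (Vec d)) (B : Vec d → Vec d) (τ : ℝ)
    (α ρ : ℕ → ℝ) (ε e : ℕ → Vec d) (z : ℕ → Vec d) (w x y : ℕ → Fin (n + 1) → Vec d) :
    Prop where
  sum_w_zero : ∑ i, w 0 i = 0
  x_resolvent : ∀ (k : ℕ) (i : Fin n),
    x k i.castSucc ∈ resolventOp τ (A i) (z k + τ • w k i.castSucc)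
  y_resolvent : ∀ (k : ℕ) (i : Fin n),
    y k i.castSucc = τ⁻¹ • ((z k + τ • w k i.castSucc) - x k i.castSucc)
  x_last : ∀ k, x k (Fin.last n) = z k - ρ k • ((B (z k) + ε k) - w k (Fin.last n))
  y_last : ∀ k, y k (Fin.last n) = B (x k (Fin.last n)) + e k
  z_succ : ∀ k, z (k + 1) = z k - α k • ∑ i, y k i
  w_succ : ∀ (k : ℕ) (i : Fin (n + 1)),
    w (k + 1) i = w k i - α k • (x k i - ((n : ℝ) + 1)⁻¹ • ∑ j, x k j)

/-- The σ-algebra generated by the primal-dual iterates up to index `k`. -/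
abbrev pastSigma {Ω : Type*} {d n : ℕ} (z : ℕ → Ω → Vec d) (w : ℕ → Ω → Fin (n + 1) → Vec d)
    (k : ℕ) : MeasurableSpace Ω :=
  ⨆ (j : ℕ) (_ : j ≤ k), MeasurableSpace.comap (fun ω => (z j ω, w j ω)) inferInstance

/-- The σ-algebra generated by the random vector `X`. -/
abbrev noiseSigma {Ω : Type*} {d : ℕ} (X : Ω → Vec d) : MeasurableSpace Ω :=
  MeasurableSpace.comap X inferInstance

end SPS

/-!
The squared Euclidean distance of the iterate to an extended solution `q` decreases at every step
by a multiple of `α k * ρ k * residual`, up to an error of relative size `α k ^ 2 + α k * ρ k ^ 2`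
and to terms linear in the noise: a step moves along the gradient of an affine separator which is
nonpositive at `q`, and at the current iterate the separator dominates the residual because the
products `ρ k * L` stay away from `1`. In the linear terms `ε` and `e` are paired with vectors that
depend on the current iterate alone, hence they have mean zero given the past. So the squared
distance is an almost supermartingale with summable growth rates: almost surely it converges and
`∑ α k * ρ k * residual` is finite. As `∑ α k * ρ k = ∞`, the residual tends to zero along a
subsequence, and by maximal monotonicity the iterates have a cluster point in the extended solution
set. On one event of full measure the distances to a countable dense set of extended solutions
converge, which makes this cluster point the limit.
-/

namespace SPS

section Sequences

theorem tendsto_of_mapClusterPt_of_tendsto_dist {ι X : Type*} [PseudoMetricSpace X]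
    {l : Filter ι} {u : ι → X} {D : Set X} {a : X} (ha : a ∈ closure D)
    (hD : ∀ q ∈ D, ∃ c, Tendsto (fun k => dist (u k) q) l (𝓝 c)) (hu : MapClusterPt a l u) :
    Tendsto u l (𝓝 a) := by
  refine Metric.tendsto_nhds.2 fun δ hδ => ?_
  obtain ⟨q, hq, haq⟩ := Metric.mem_closure_iff.1 ha (δ / 2) (half_pos hδ)
  obtain ⟨c, hc⟩ := hD q hq
  have hcluster : MapClusterPt (dist a q) l fun k => dist (u k) q :=
    hu.continuousAt_comp (f := fun x => dist x q) (by fun_prop)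
  obtain rfl : dist a q = c := eq_of_nhds_neBot (ClusterPt.mono hcluster hc)
  filter_upwards [hc.eventually_lt_const haq] with k hk
  linarith [dist_triangle_right (u k) a q]

theorem mapClusterPt_zero_of_summable_mul {b r : ℕ → ℝ} (hb : ∀ k, 0 ≤ b k) (hr : ∀ k, 0 ≤ r k)
    (hdiv : ¬ Summable b) (hsum : Summable fun k => b k * r k) : MapClusterPt 0 atTop r := by
  refine mapClusterPt_iff_frequently.2 fun s hs => ?_
  by_contra hfar
  obtain ⟨δ, hδ, hball⟩ := Metric.mem_nhds_iff.1 hs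
  refine hdiv (.of_norm_bounded_eventually_nat (hsum.mul_left δ⁻¹) ?_)
  filter_upwards [not_frequently.1 hfar] with k hk
  have hδr : δ ≤ r k := by
    by_contra! hlt
    exact hk (hball (by simpa [abs_of_nonneg (hr k)] using hlt))
  calc ‖b k‖ = δ⁻¹ * (b k * δ) := by rw [Real.norm_of_nonneg (hb k)]; field_simp
    _ ≤ δ⁻¹ * (b k * r k) := by gcongr; exact hb k

end Sequences

section PrimalDual

variable {E ι : Type*} [NormedAddCommGroup E] [InnerProductSpace ℝ E] [Fintype ι]

/-- The identification of the primal-dual space `E × (ι → E)`, which carries the sup norm, with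
the Hilbert sum of its factors. It is used to measure distances in the Euclidean norm. -/
noncomputable def toL2 : (E × (ι → E)) ≃L[ℝ] WithLp 2 (E × PiLp 2 fun _ : ι => E) :=
  ((ContinuousLinearEquiv.refl ℝ E).prodCongr
      (PiLp.continuousLinearEquiv 2 ℝ fun _ : ι => E).symm).trans
    (WithLp.prodContinuousLinearEquiv 2 ℝ E (PiLp 2 fun _ : ι => E)).symm

theorem inner_toL2 (p q : E × (ι → E)) :
    inner ℝ (toL2 p) (toL2 q) = inner ℝ p.1 q.1 + ∑ i, inner ℝ (p.2 i) (q.2 i) := by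
  simp [toL2, WithLp.prod_inner_apply, PiLp.inner_apply]

theorem norm_toL2_sq (p : E × (ι → E)) : ‖toL2 p‖ ^ 2 = ‖p.1‖ ^ 2 + ∑ i, ‖p.2 i‖ ^ 2 := by
  simp only [← real_inner_self_eq_norm_sq, inner_toL2]

theorem norm_fst_sq_add_norm_snd_sq_le (p : E × (ι → E)) (i : ι) :
    ‖p.1‖ ^ 2 + ‖p.2 i‖ ^ 2 ≤ ‖toL2 p‖ ^ 2 := by
  rw [norm_toL2_sq]
  gcongr
  exact Finset.single_le_sum (f := fun i => ‖p.2 i‖ ^ 2) (fun i _ => by positivity)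
    (Finset.mem_univ i)

end PrimalDual

section Separator

theorem norm_sum_sq_le {E ι : Type*} [SeminormedAddCommGroup E] [Fintype ι] (u : ι → E) :
    ‖∑ i, u i‖ ^ 2 ≤ Fintype.card ι * ∑ i, ‖u i‖ ^ 2 :=
  calc ‖∑ i, u i‖ ^ 2 ≤ (∑ i, ‖u i‖) ^ 2 := by gcongr; exact norm_sum_le _ _
    _ ≤ Fintype.card ι * ∑ i, ‖u i‖ ^ 2 := sq_sum_le_card_mul_sum_sq

theorem norm_add_sub_sq_le {E : Type*} [SeminormedAddCommGroup E] {B : E → E} {L : ℝ≥0}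
    (hBlip : LipschitzWith L B) (x a e : E) :
    ‖(B x + e) - B a‖ ^ 2 ≤ 2 * L ^ 2 * ‖x - a‖ ^ 2 + 2 * ‖e‖ ^ 2 := by
  have htriangle : ‖(B x + e) - B a‖ ≤ L * ‖x - a‖ + ‖e‖ := by
    rw [add_sub_right_comm]
    exact (norm_add_le _ _).trans (add_le_add_left (hBlip.norm_sub_le x a) _)
  calc ‖(B x + e) - B a‖ ^ 2 ≤ (L * ‖x - a‖ + ‖e‖) ^ 2 := by gcongr
    _ ≤ 2 * ((L * ‖x - a‖) ^ 2 + ‖e‖ ^ 2) := add_sq_le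
    _ = _ := by ring

variable {E ι : Type*} [NormedAddCommGroup E] [InnerProductSpace ℝ E] [Fintype ι]

theorem sum_sub_average_eq_zero [Nonempty ι] (u : ι → E) :
    ∑ i, (u i - (Fintype.card ι : ℝ)⁻¹ • ∑ j, u j) = 0 := by
  rw [Finset.sum_sub_distrib, Finset.sum_const, Finset.card_univ, ← Nat.cast_smul_eq_nsmul ℝ,
    smul_inv_smul₀ (Nat.cast_ne_zero.2 Fintype.card_ne_zero), sub_self]

theorem sum_norm_sub_average_sq_le [Nonempty ι] (u : ι → E) (c : E) :
    ∑ i, ‖u i - (Fintype.card ι : ℝ)⁻¹ • ∑ j, u j‖ ^ 2 ≤ ∑ i, ‖u i - c‖ ^ 2 := by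
  set m : E := (Fintype.card ι : ℝ)⁻¹ • ∑ j, u j
  have hpythagoras : ∑ i, ‖u i - c‖ ^ 2 = ∑ i, ‖u i - m‖ ^ 2 + ∑ _i : ι, ‖m - c‖ ^ 2 := by
    have hi (i : ι) : ‖u i - c‖ ^ 2
        = ‖u i - m‖ ^ 2 + 2 * inner ℝ (u i - m) (m - c) + ‖m - c‖ ^ 2 := by
      rw [← norm_add_sq_real, sub_add_sub_cancel]
    simp only [hi, Finset.sum_add_distrib, ← Finset.mul_sum, ← sum_inner, m,
      sum_sub_average_eq_zero, inner_zero_left, mul_zero, add_zero]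
  rw [hpythagoras]
  exact le_add_of_nonneg_right (by positivity)

/-- The separator of projective splitting defined by the points `x i` and `y i`. It is nonpositive
at every extended solution when `y i` is a value at `x i` of the `i`-th operator. -/
noncomputable def separator (x y : ι → E) (p : E × (ι → E)) : ℝ :=
  ∑ i, inner ℝ (p.1 - x i) (y i - p.2 i)

/-- The gradient of the separator along the subspace of the points whose dual components sum to
zero, on which the separator is affine. -/
noncomputable def separatorGradient (x y : ι → E) : E × (ι → E) :=
  (∑ i, y i, fun i => x i - (Fintype.card ι : ℝ)⁻¹ • ∑ j, x j)

theorem separator_eq_inner_sub (x y : ι → E) {p : E × (ι → E)} (hp : ∑ i, p.2 i = 0) :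
    separator x y p
      = inner ℝ (toL2 p) (toL2 (separatorGradient x y)) - ∑ i, inner ℝ (x i) (y i) := by
  simp only [separator, separatorGradient, inner_toL2, inner_sub_left, inner_sub_right,
    Finset.sum_sub_distrib, ← inner_sum, ← sum_inner, hp, inner_zero_left,
    real_inner_comm (p.2 _)]
  ring

theorem norm_toL2_sub_smul_separatorGradient_sub_sq (x y : ι → E) {p q : E × (ι → E)}
    (hp : ∑ i, p.2 i = 0) (hq : ∑ i, q.2 i = 0) (α : ℝ) :
    ‖toL2 (p - α • separatorGradient x y - q)‖ ^ 2
      = ‖toL2 (p - q)‖ ^ 2 - 2 * α * (separator x y p - separator x y q)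
        + α ^ 2 * ‖toL2 (separatorGradient x y)‖ ^ 2 := by
  rw [separator_eq_inner_sub x y hp, separator_eq_inner_sub x y hq, sub_sub_sub_cancel_right,
    ← inner_sub_left, ← map_sub, sub_right_comm, map_sub toL2 (p - q), map_smul,
    norm_sub_sq_real, inner_smul_right, norm_smul, mul_pow, Real.norm_eq_abs, sq_abs]
  ring

theorem norm_toL2_separatorGradient_sq_le [Nonempty ι] (x y : ι → E) {q : E × (ι → E)}
    (hq : ∑ i, q.2 i = 0) :
    ‖toL2 (separatorGradient x y)‖ ^ 2
      ≤ Fintype.card ι * ∑ i, (‖x i - q.1‖ ^ 2 + ‖y i - q.2 i‖ ^ 2) := by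
  have hprimal : ‖∑ i, y i‖ ^ 2 ≤ Fintype.card ι * ∑ i, ‖y i - q.2 i‖ ^ 2 := by
    simpa [Finset.sum_sub_distrib, hq] using norm_sum_sq_le fun i => y i - q.2 i
  have hdual : ∑ i, ‖x i - (Fintype.card ι : ℝ)⁻¹ • ∑ j, x j‖ ^ 2
      ≤ Fintype.card ι * ∑ i, ‖x i - q.1‖ ^ 2 :=
    (sum_norm_sub_average_sq_le x q.1).trans <|
      le_mul_of_one_le_left (by positivity) (mod_cast Fintype.card_pos)
  rw [norm_toL2_sq, Finset.sum_add_distrib, mul_add, add_comm]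
  exact add_le_add hdual hprimal

end Separator

section Blocks

variable {E : Type*} [NormedAddCommGroup E] [InnerProductSpace ℝ E]

theorem norm_sq_add_sq_mul_norm_sq_le {τ : ℝ} (hτ : 0 ≤ τ) {x u : E} (h : 0 ≤ inner ℝ u x) :
    ‖x‖ ^ 2 + τ ^ 2 * ‖u‖ ^ 2 ≤ ‖x + τ • u‖ ^ 2 := by
  rw [norm_add_sq_real, norm_smul, inner_smul_right, real_inner_comm, mul_pow, Real.norm_eq_abs,
    sq_abs]
  linarith [mul_nonneg hτ h]

theorem norm_add_smul_sq_le (τ : ℝ) (z w : E) :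
    ‖z + τ • w‖ ^ 2 ≤ (1 + τ ^ 2) * (‖z‖ ^ 2 + ‖w‖ ^ 2) := by
  have htriangle : ‖z + τ • w‖ ≤ ‖z‖ + |τ| * ‖w‖ := by
    simpa [norm_smul] using norm_add_le z (τ • w)
  calc ‖z + τ • w‖ ^ 2 ≤ (‖z‖ + |τ| * ‖w‖) ^ 2 := by gcongr
    _ ≤ (1 + |τ| ^ 2) * (‖z‖ ^ 2 + ‖w‖ ^ 2) := by linarith [sq_nonneg (|τ| * ‖z‖ - ‖w‖)]
    _ = (1 + τ ^ 2) * (‖z‖ ^ 2 + ‖w‖ ^ 2) := by rw [sq_abs]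

theorem norm_sq_add_norm_sq_le_of_add_smul_eq {τ : ℝ} (hτ : 0 < τ) {x u z w : E}
    (h : 0 ≤ inner ℝ u x) (heq : x + τ • u = z + τ • w) :
    ‖x‖ ^ 2 + ‖u‖ ^ 2 ≤ (1 + (τ ^ 2)⁻¹) * (1 + τ ^ 2) * (‖z‖ ^ 2 + ‖w‖ ^ 2) := by
  have hτu : ‖u‖ ^ 2 = (τ ^ 2)⁻¹ * (τ ^ 2 * ‖u‖ ^ 2) := by field_simp
  calc ‖x‖ ^ 2 + ‖u‖ ^ 2 ≤ (1 + (τ ^ 2)⁻¹) * (‖x‖ ^ 2 + τ ^ 2 * ‖u‖ ^ 2) := by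
        have h₁ : 0 ≤ τ ^ 2 * ‖u‖ ^ 2 := by positivity
        have h₂ : 0 ≤ (τ ^ 2)⁻¹ * ‖x‖ ^ 2 := by positivity
        linarith
    _ ≤ (1 + (τ ^ 2)⁻¹) * ‖z + τ • w‖ ^ 2 := by
        rw [← heq]; gcongr; exact norm_sq_add_sq_mul_norm_sq_le hτ.le h
    _ ≤ (1 + (τ ^ 2)⁻¹) * ((1 + τ ^ 2) * (‖z‖ ^ 2 + ‖w‖ ^ 2)) := by
        gcongr; exact norm_add_smul_sq_le τ z w
    _ = _ := by ring

theorem inner_sub_sub_eq_smul_norm_sq {τ : ℝ} {x y z w : E} (h : x + τ • y = z + τ • w) :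
    inner ℝ (z - x) (y - w) = τ * ‖y - w‖ ^ 2 := by
  have hzx : z - x = τ • (y - w) := by
    rw [smul_sub, sub_eq_sub_iff_add_eq_add, add_comm (τ • y), h]
  rw [hzx, real_inner_smul_left, real_inner_self_eq_norm_sq]

variable {B : E → E} {L : ℝ≥0}

theorem neg_mul_norm_sub_sq_le_inner (hBlip : LipschitzWith L B) (x z : E) :
    -(L * ‖z - x‖ ^ 2) ≤ inner ℝ (z - x) (B x - B z) := by
  refine neg_le_of_abs_le ((abs_real_inner_le_norm _ _).trans ?_)
  calc ‖z - x‖ * ‖B x - B z‖ ≤ ‖z - x‖ * (L * ‖z - x‖) := by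
        gcongr; rw [norm_sub_rev z x]; exact hBlip.norm_sub_le x z
    _ = L * ‖z - x‖ ^ 2 := by ring

theorem le_inner_sub_inner_of_forward_step (hBlip : LipschitzWith L B)
    (hBmono : ∀ u v, 0 ≤ inner ℝ (B u - B v) (u - v)) {r : ℝ} {x z w ε : E}
    (hx : x = z - r • ((B z + ε) - w)) (e a : E) :
    r * (1 - r * L) * ‖B z - w‖ ^ 2 + inner ℝ (z - a) e
        + (r - 2 * L * r ^ 2) * inner ℝ (B z - w) ε - L * r ^ 2 * ‖ε‖ ^ 2
      ≤ inner ℝ (z - x) ((B x + e) - w) - inner ℝ (a - x) ((B x + e) - B a) := by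
  have hzx : z - x = r • ((B z - w) + ε) := by rw [hx]; module
  have hnorm : ‖z - x‖ ^ 2 = r ^ 2 * (‖B z - w‖ ^ 2 + 2 * inner ℝ (B z - w) ε + ‖ε‖ ^ 2) := by
    rw [hzx, norm_smul, mul_pow, Real.norm_eq_abs, sq_abs, norm_add_sq_real]
  have hforward : inner ℝ (z - x) (B z - w) = r * (‖B z - w‖ ^ 2 + inner ℝ (B z - w) ε) := by
    rw [hzx, real_inner_smul_left, inner_add_left, real_inner_self_eq_norm_sq, real_inner_comm]
  have hdecomp : inner ℝ (z - x) ((B x + e) - w) - inner ℝ (a - x) ((B x + e) - B a)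
      = inner ℝ (z - x) (B z - w) + inner ℝ (z - x) (B x - B z)
        + inner ℝ (B x - B a) (x - a) + inner ℝ (z - a) e := by
    rw [real_inner_comm (x - a)]
    simp only [inner_sub_left, inner_sub_right, inner_add_right]
    ring
  have hlip := neg_mul_norm_sub_sq_le_inner hBlip x z
  rw [hnorm] at hlip
  rw [hdecomp, hforward]
  linarith [hBmono x a]

theorem norm_forward_step_sub_sq_le (hBlip : LipschitzWith L B) {r rbar : ℝ} (hr : 0 ≤ r)
    (hrbar : r ≤ rbar) {x z w ε : E} (hx : x = z - r • ((B z + ε) - w)) (a : E) :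
    ‖x - a‖ ^ 2
      ≤ 3 * ((1 + rbar * L) ^ 2 + rbar ^ 2) * (‖z - a‖ ^ 2 + ‖w - B a‖ ^ 2 + ‖ε‖ ^ 2) := by
  have hrbar0 : 0 ≤ rbar := hr.trans hrbar
  have hdecomp : x - a = ((z - a) - r • (B z - B a)) + r • (w - B a) - r • ε := by
    rw [hx]; module
  have htriangle : ‖x - a‖ ≤ (1 + rbar * L) * ‖z - a‖ + rbar * ‖w - B a‖ + rbar * ‖ε‖ :=
    calc ‖x - a‖ ≤ ‖z - a‖ + r * ‖B z - B a‖ + r * ‖w - B a‖ + r * ‖ε‖ := by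
          rw [hdecomp]
          refine (norm_sub_le _ _).trans (add_le_add ((norm_add_le _ _).trans
            (add_le_add (norm_sub_le _ _) le_rfl)) le_rfl) |>.trans_eq ?_
          simp only [norm_smul, Real.norm_of_nonneg hr]
      _ ≤ ‖z - a‖ + rbar * (L * ‖z - a‖) + rbar * ‖w - B a‖ + rbar * ‖ε‖ := by
          gcongr; exact hBlip.norm_sub_le z a
      _ = _ := by ring
  set t := 1 + rbar * L
  have hcross : 0 ≤ t ^ 2 * (‖w - B a‖ ^ 2 + ‖ε‖ ^ 2) + rbar ^ 2 * ‖z - a‖ ^ 2 := by positivity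
  calc ‖x - a‖ ^ 2 ≤ (t * ‖z - a‖ + rbar * ‖w - B a‖ + rbar * ‖ε‖) ^ 2 := by gcongr
    _ ≤ 3 * (t ^ 2 * ‖z - a‖ ^ 2 + rbar ^ 2 * ‖w - B a‖ ^ 2 + rbar ^ 2 * ‖ε‖ ^ 2) := by
        linarith [sq_nonneg (t * ‖z - a‖ - rbar * ‖w - B a‖),
          sq_nonneg (t * ‖z - a‖ - rbar * ‖ε‖), sq_nonneg (rbar * ‖w - B a‖ - rbar * ‖ε‖)]
    _ ≤ _ := by linarith

end Blocks

section Operators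

variable {d n : ℕ}

theorem mem_resolventOp_iff {τ : ℝ} {A : Vec d → Set (Vec d)} {t x : Vec d} :
    x ∈ resolventOp τ A t ↔ ∃ u ∈ A x, x + τ • u = t := by
  simp [resolventOp, Set.mem_smul_set, eq_neg_add_iff_add_eq]

theorem IsMonotoneOp.exists_continuous_resolvent {A : Vec d → Set (Vec d)} (hA : IsMonotoneOp A)
    {τ : ℝ} (hτ : 0 ≤ τ) :
    ∃ J : Vec d → Vec d, Continuous J ∧ ∀ t x, x ∈ resolventOp τ A t → x = J t := by
  have hnonexpansive {t t' x x'} (hx : x ∈ resolventOp τ A t) (hx' : x' ∈ resolventOp τ A t') :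
      dist x x' ≤ dist t t' := by
    obtain ⟨u, hu, rfl⟩ := mem_resolventOp_iff.1 hx
    obtain ⟨v, hv, rfl⟩ := mem_resolventOp_iff.1 hx'
    rw [dist_eq_norm, dist_eq_norm, add_sub_add_comm, ← smul_sub]
    refine le_of_sq_le_sq ?_ (norm_nonneg _)
    exact (le_add_of_nonneg_right (by positivity)).trans
      (norm_sq_add_sq_mul_norm_sq_le hτ (hA hu hv))
  choose! f hf using fun t (ht : (resolventOp τ A t).Nonempty) => ht
  have hlip : LipschitzOnWith 1 f {t | (resolventOp τ A t).Nonempty} :=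
    .of_dist_le_mul fun s hs t ht => by simpa using hnonexpansive (hf s hs) (hf t ht)
  obtain ⟨J, hJ, hfJ⟩ := hlip.extend_finite_dimension
  refine ⟨J, hJ.continuous, fun t x hx => ?_⟩
  have hunique : x = f t := dist_le_zero.1 (by simpa using hnonexpansive hx (hf t ⟨x, hx⟩))
  rw [hunique, hfJ ⟨x, hx⟩]

theorem IsMaximalMonotone.mem_of_forall {A : Vec d → Set (Vec d)} (hA : IsMaximalMonotone A)
    {y v : Vec d} (h : ∀ x u, u ∈ A x → 0 ≤ inner ℝ (u - v) (x - y)) : v ∈ A y := by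
  have hmono : IsMonotoneOp fun x => A x ∪ {u | x = y ∧ u = v} := by
    rintro x x' u u' (hu | ⟨rfl, rfl⟩) (hu' | ⟨rfl, rfl⟩)
    · exact hA.1 hu hu'
    · exact h _ _ hu
    · rw [← neg_sub u' u, ← neg_sub x' x, inner_neg_neg]
      exact h _ _ hu'
    · simp
  rw [← hA.2 _ hmono fun x => Set.subset_union_left]
  exact Or.inr ⟨rfl, rfl⟩

theorem IsMaximalMonotone.mem_of_tendsto {ι : Type*} {l : Filter ι} [l.NeBot]
    {A : Vec d → Set (Vec d)} (hA : IsMaximalMonotone A) {x u : ι → Vec d} {y v : Vec d}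
    (hxu : ∀ k, u k ∈ A (x k)) (hx : Tendsto x l (𝓝 y)) (hu : Tendsto u l (𝓝 v)) : v ∈ A y :=
  hA.mem_of_forall fun _ _ hu' =>
    ge_of_tendsto' ((tendsto_const_nhds.sub hu).inner (tendsto_const_nhds.sub hx))
      fun k => hA.1 hu' (hxu k)

variable {A : Fin n → Vec d → Set (Vec d)} {B : Vec d → Vec d}

theorem exists_mem_extendedSolutionSet {z : Vec d} (h : IsSolution A B z) :
    ∃ w, (z, w) ∈ extendedSolutionSet A B := by
  obtain ⟨_, hs, _, rfl, h0⟩ := Set.mem_add.1 h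
  obtain ⟨g, hg, rfl⟩ := (Set.mem_fintype_sum _ _).1 hs
  refine ⟨Fin.snoc g (B z), fun i => ?_, ?_, ?_⟩
  · simpa using hg i
  · simp
  · simpa [Fin.sum_univ_castSucc] using h0

theorem isSolution_of_mem_extendedSolutionSet {p : Vec d × (Fin (n + 1) → Vec d)}
    (h : p ∈ extendedSolutionSet A B) : IsSolution A B p.1 := by
  obtain ⟨hA, hB, hsum⟩ := h
  refine Set.mem_add.2 ⟨∑ i : Fin n, p.2 i.castSucc, ?_, B p.1, rfl, ?_⟩
  · exact (Set.mem_fintype_sum _ _).2 ⟨fun i => p.2 i.castSucc, hA, rfl⟩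
  · rw [← hsum, Fin.sum_univ_castSucc, hB]

end Operators

section Run

variable {d n : ℕ} {A : Fin n → Vec d → Set (Vec d)} {B : Vec d → Vec d} {τ : ℝ} {L : ℝ≥0}
  {α ρ : ℕ → ℝ} {ρbar c : ℝ} {ε e z : ℕ → Vec d} {w x y : ℕ → Fin (n + 1) → Vec d}
  {q : Vec d × (Fin (n + 1) → Vec d)}

theorem IsRun.succ_eq (h : IsRun A B τ α ρ ε e z w x y) (k : ℕ) :
    (z (k + 1), w (k + 1)) = (z k, w k) - α k • separatorGradient (x k) (y k) := by
  ext1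
  · exact h.z_succ k
  · funext i
    simpa [separatorGradient] using h.w_succ k i

theorem IsRun.sum_w_eq_zero (h : IsRun A B τ α ρ ε e z w x y) (k : ℕ) : ∑ i, w k i = 0 := by
  induction k with
  | zero => exact h.sum_w_zero
  | succ k ih =>
    have hw : w (k + 1) = w k - α k • (separatorGradient (x k) (y k)).2 :=
      congrArg Prod.snd (h.succ_eq k)
    simp only [hw, separatorGradient, Pi.sub_apply, Pi.smul_apply, Finset.sum_sub_distrib (w k),
      ih, ← Finset.smul_sum, sum_sub_average_eq_zero, smul_zero, sub_zero]

theorem IsRun.x_add_smul_y (h : IsRun A B τ α ρ ε e z w x y) (hτ : τ ≠ 0) (k : ℕ) (i : Fin n) :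
    x k i.castSucc + τ • y k i.castSucc = z k + τ • w k i.castSucc := by
  rw [h.y_resolvent, smul_inv_smul₀ hτ, add_sub_cancel]

theorem IsRun.y_mem (h : IsRun A B τ α ρ ε e z w x y) (hτ : τ ≠ 0) (k : ℕ) (i : Fin n) :
    y k i.castSucc ∈ A i (x k i.castSucc) := by
  obtain ⟨u, hu, hxu⟩ := mem_resolventOp_iff.1 (h.x_resolvent k i)
  rwa [h.y_resolvent, ← hxu, add_sub_cancel_left, inv_smul_smul₀ hτ]

theorem IsRun.inner_sub_nonneg (h : IsRun A B τ α ρ ε e z w x y) (hτ : τ ≠ 0)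
    (hA : ∀ i, IsMonotoneOp (A i)) (hq : q ∈ extendedSolutionSet A B) (k : ℕ) (i : Fin n) :
    0 ≤ inner ℝ (y k i.castSucc - q.2 i.castSucc) (x k i.castSucc - q.1) :=
  hA i (h.y_mem hτ k i) (hq.1 i)

/-- The sum of the squared distances by which an iterate violates the inclusions that define the
extended solution set. The terms of the resolvent blocks are measured at the points `y i`. -/
noncomputable def residual (B : Vec d → Vec d) (z : Vec d) (w y : Fin (n + 1) → Vec d) : ℝ :=
  ∑ i : Fin n, ‖y i.castSucc - w i.castSucc‖ ^ 2 + ‖B z - w (Fin.last n)‖ ^ 2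

theorem residual_nonneg (B : Vec d → Vec d) (z : Vec d) (w y : Fin (n + 1) → Vec d) :
    0 ≤ residual B z w y := by
  unfold residual
  positivity

theorem IsRun.le_separator_sub_separator (h : IsRun A B τ α ρ ε e z w x y) (hτ : 0 < τ)
    (hA : ∀ i, IsMonotoneOp (A i)) (hBlip : LipschitzWith L B)
    (hBmono : ∀ u v, 0 ≤ inner ℝ (B u - B v) (u - v)) (hρ : ∀ k, 0 ≤ ρ k)
    (hρbar : ∀ k, ρ k ≤ ρbar) (hc : 0 ≤ c) (hcτ : c * ρbar ≤ τ) (hcL : c ≤ 1 - ρbar * L)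
    (hq : q ∈ extendedSolutionSet A B) (k : ℕ) :
    c * ρ k * residual B (z k) (w k) (y k) + inner ℝ (z k - q.1) (e k)
        + (ρ k - 2 * L * ρ k ^ 2) * inner ℝ (B (z k) - w k (Fin.last n)) (ε k)
        - L * ρ k ^ 2 * ‖ε k‖ ^ 2
      ≤ separator (x k) (y k) (z k, w k) - separator (x k) (y k) q := by
  have hresolvent (i : Fin n) : c * ρ k * ‖y k i.castSucc - w k i.castSucc‖ ^ 2
      ≤ inner ℝ (z k - x k i.castSucc) (y k i.castSucc - w k i.castSucc)
        - inner ℝ (q.1 - x k i.castSucc) (y k i.castSucc - q.2 i.castSucc) := by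
    have hcρ : c * ρ k ≤ τ := (mul_le_mul_of_nonneg_left (hρbar k) hc).trans hcτ
    have hmono := h.inner_sub_nonneg hτ.ne' hA hq k i
    rw [real_inner_comm, ← neg_sub q.1, inner_neg_left] at hmono
    rw [inner_sub_sub_eq_smul_norm_sq (h.x_add_smul_y hτ.ne' k i)]
    linarith [mul_le_mul_of_nonneg_right hcρ (sq_nonneg ‖y k i.castSucc - w k i.castSucc‖)]
  have hforward := le_inner_sub_inner_of_forward_step hBlip hBmono (h.x_last k) (e k) q.1
  have hcoeff : c * ρ k ≤ ρ k * (1 - ρ k * L) := by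
    rw [mul_comm]
    gcongr
    · exact hρ k
    · exact hcL.trans (by gcongr; exact hρbar k)
  have hlast := mul_le_mul_of_nonneg_right hcoeff (sq_nonneg ‖B (z k) - w k (Fin.last n)‖)
  have hsum := Finset.sum_le_sum fun i (_ : i ∈ Finset.univ) => hresolvent i
  rw [Finset.sum_sub_distrib, ← Finset.mul_sum] at hsum
  simp only [separator, residual, Fin.sum_univ_castSucc, h.y_last, hq.2.1]
  linarith

/-- The factor by which the squared distance of the current iterate to an extended solution and
the squared noise bound the squared distances of the points `x i` and `y i` to that solution. -/
noncomputable def growthConstant (n : ℕ) (L : ℝ≥0) (τ ρbar : ℝ) : ℝ :=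
  n * ((1 + (τ ^ 2)⁻¹) * (1 + τ ^ 2))
    + ((1 + 2 * L ^ 2) * (3 * ((1 + ρbar * L) ^ 2 + ρbar ^ 2)) + 2)

theorem IsRun.sum_norm_sub_sq_le (h : IsRun A B τ α ρ ε e z w x y) (hτ : 0 < τ)
    (hA : ∀ i, IsMonotoneOp (A i)) (hBlip : LipschitzWith L B) (hρ : ∀ k, 0 ≤ ρ k)
    (hρbar : ∀ k, ρ k ≤ ρbar) (hq : q ∈ extendedSolutionSet A B) (k : ℕ) :
    ∑ i, (‖x k i - q.1‖ ^ 2 + ‖y k i - q.2 i‖ ^ 2)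
      ≤ growthConstant n L τ ρbar
        * (‖toL2 ((z k, w k) - q)‖ ^ 2 + ‖ε k‖ ^ 2 + ‖e k‖ ^ 2) := by
  set R := ‖toL2 ((z k, w k) - q)‖ ^ 2 + ‖ε k‖ ^ 2 + ‖e k‖ ^ 2 with hR
  have hcoord (i : Fin (n + 1)) : ‖z k - q.1‖ ^ 2 + ‖w k i - q.2 i‖ ^ 2 + ‖ε k‖ ^ 2 ≤ R := by
    have := norm_fst_sq_add_norm_snd_sq_le ((z k, w k) - q) i
    simp only [Prod.fst_sub, Prod.snd_sub, Pi.sub_apply] at this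
    linarith [sq_nonneg ‖e k‖]
  have hresolvent (i : Fin n) :
      ‖x k i.castSucc - q.1‖ ^ 2 + ‖y k i.castSucc - q.2 i.castSucc‖ ^ 2
        ≤ (1 + (τ ^ 2)⁻¹) * (1 + τ ^ 2) * R := by
    refine (norm_sq_add_norm_sq_le_of_add_smul_eq hτ (h.inner_sub_nonneg hτ.ne' hA hq k i)
      (z := z k - q.1) (w := w k i.castSucc - q.2 i.castSucc) ?_).trans ?_
    · rw [smul_sub, smul_sub, ← add_sub_add_comm, ← add_sub_add_comm, h.x_add_smul_y hτ.ne']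
    · gcongr
      linarith [hcoord i.castSucc, sq_nonneg ‖ε k‖]
  have hx : ‖x k (Fin.last n) - q.1‖ ^ 2 ≤ 3 * ((1 + ρbar * L) ^ 2 + ρbar ^ 2) * R := by
    refine (norm_forward_step_sub_sq_le hBlip (hρ k) (hρbar k) (h.x_last k) q.1).trans ?_
    gcongr
    exact hq.2.1 ▸ hcoord (Fin.last n)
  have hy := norm_add_sub_sq_le hBlip (x k (Fin.last n)) q.1 (e k)
  rw [← h.y_last, ← hq.2.1] at hy
  have he : ‖e k‖ ^ 2 ≤ R := by rw [hR]; exact le_add_of_nonneg_left (by positivity)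
  calc ∑ i, (‖x k i - q.1‖ ^ 2 + ‖y k i - q.2 i‖ ^ 2)
      ≤ ∑ _i : Fin n, (1 + (τ ^ 2)⁻¹) * (1 + τ ^ 2) * R
        + ((1 + 2 * L ^ 2) * ‖x k (Fin.last n) - q.1‖ ^ 2 + 2 * ‖e k‖ ^ 2) := by
        rw [Fin.sum_univ_castSucc]
        exact add_le_add (Finset.sum_le_sum fun i _ => hresolvent i) (by linarith)
    _ ≤ n * ((1 + (τ ^ 2)⁻¹) * (1 + τ ^ 2) * R)
        + ((1 + 2 * L ^ 2) * (3 * ((1 + ρbar * L) ^ 2 + ρbar ^ 2) * R) + 2 * R) := by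
        rw [Finset.sum_const, Finset.card_univ, Fintype.card_fin, nsmul_eq_mul]
        gcongr
    _ = growthConstant n L τ ρbar * R := by rw [growthConstant]; ring

/-- The relative error of a step with stepsizes `a` and `r`: the factor of the squared distance
and the squared noise in the one-step bound. -/
noncomputable def stepError (n : ℕ) (L : ℝ≥0) (τ ρbar a r : ℝ) : ℝ :=
  2 * L * (a * r ^ 2) + (n + 1) * growthConstant n L τ ρbar * a ^ 2

theorem stepError_nonneg (n : ℕ) (L : ℝ≥0) (τ ρbar r : ℝ) {a : ℝ} (ha : 0 ≤ a) :
    0 ≤ stepError n L τ ρbar a r := by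
  unfold stepError growthConstant
  positivity

theorem summable_stepError (n : ℕ) (L : ℝ≥0) (τ ρbar : ℝ) (hα2 : Summable fun k => α k ^ 2)
    (hαρ2 : Summable fun k => α k * ρ k ^ 2) :
    Summable fun k => stepError n L τ ρbar (α k) (ρ k) :=
  (hαρ2.mul_left _).add (hα2.mul_left _)

theorem IsRun.norm_toL2_sub_sq_succ_le (h : IsRun A B τ α ρ ε e z w x y) (hτ : 0 < τ)
    (hA : ∀ i, IsMonotoneOp (A i)) (hBlip : LipschitzWith L B)
    (hBmono : ∀ u v, 0 ≤ inner ℝ (B u - B v) (u - v)) (hα : ∀ k, 0 ≤ α k) (hρ : ∀ k, 0 ≤ ρ k)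
    (hρbar : ∀ k, ρ k ≤ ρbar) (hc : 0 ≤ c) (hcτ : c * ρbar ≤ τ) (hcL : c ≤ 1 - ρbar * L)
    (hq : q ∈ extendedSolutionSet A B) (k : ℕ) :
    ‖toL2 ((z (k + 1), w (k + 1)) - q)‖ ^ 2
        + 2 * c * (α k * ρ k * residual B (z k) (w k) (y k))
      ≤ ‖toL2 ((z k, w k) - q)‖ ^ 2
        + stepError n L τ ρbar (α k) (ρ k)
          * (‖toL2 ((z k, w k) - q)‖ ^ 2 + ‖ε k‖ ^ 2 + ‖e k‖ ^ 2)
        - 2 * α k * (inner ℝ (z k - q.1) (e k)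
          + (ρ k - 2 * L * ρ k ^ 2) * inner ℝ (B (z k) - w k (Fin.last n)) (ε k)) := by
  have hgap := mul_le_mul_of_nonneg_left
    (h.le_separator_sub_separator hτ hA hBlip hBmono hρ hρbar hc hcτ hcL hq k)
    (show 0 ≤ 2 * α k by linarith [hα k])
  have hgrad : ‖toL2 (separatorGradient (x k) (y k))‖ ^ 2 ≤ (n + 1) * (growthConstant n L τ ρbar
      * (‖toL2 ((z k, w k) - q)‖ ^ 2 + ‖ε k‖ ^ 2 + ‖e k‖ ^ 2)) := by
    refine (norm_toL2_separatorGradient_sq_le (x k) (y k) hq.2.2).trans ?_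
    rw [Fintype.card_fin, Nat.cast_add_one]
    gcongr
    exact h.sum_norm_sub_sq_le hτ hA hBlip hρ hρbar hq k
  have hextra : 0 ≤ 2 * L * (α k * ρ k ^ 2) * (‖toL2 ((z k, w k) - q)‖ ^ 2 + ‖e k‖ ^ 2) := by
    have := hα k
    positivity
  rw [h.succ_eq, norm_toL2_sub_smul_separatorGradient_sub_sq _ _ (h.sum_w_eq_zero k) hq.2.2,
    stepError]
  linarith [mul_le_mul_of_nonneg_left hgrad (sq_nonneg (α k))]

theorem IsRun.mem_extendedSolutionSet_of_tendsto {ι : Type*} {l : Filter ι} [l.NeBot] {φ : ι → ℕ}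
    (h : IsRun A B τ α ρ ε e z w x y) (hτ : τ ≠ 0) (hA : ∀ i, IsMaximalMonotone (A i))
    (hB : Continuous B) (hres : Tendsto (fun m => residual B (z (φ m)) (w (φ m)) (y (φ m))) l (𝓝 0))
    (hlim : Tendsto (fun m => (z (φ m), w (φ m))) l (𝓝 q)) : q ∈ extendedSolutionSet A B := by
  have hz : Tendsto (fun m => z (φ m)) l (𝓝 q.1) := hlim.fst_nhds
  have hw (i) : Tendsto (fun m => w (φ m) i) l (𝓝 (q.2 i)) := tendsto_pi_nhds.1 hlim.snd_nhds i
  have hzero {u : ι → Vec d} (hu : ∀ m, ‖u m‖ ^ 2 ≤ residual B (z (φ m)) (w (φ m)) (y (φ m))) :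
      Tendsto u l (𝓝 0) := by
    have hsq : Tendsto (fun m => ‖u m‖ ^ 2) l (𝓝 0) := squeeze_zero (fun m => sq_nonneg _) hu hres
    exact tendsto_zero_iff_norm_tendsto_zero.2 (by simpa using hsq.sqrt)
  have hyw (i : Fin n) :
      Tendsto (fun m => y (φ m) i.castSucc - w (φ m) i.castSucc) l (𝓝 0) :=
    hzero fun m => (Finset.single_le_sum (f := fun i : Fin n =>
      ‖y (φ m) i.castSucc - w (φ m) i.castSucc‖ ^ 2) (fun i _ => by positivity)
      (Finset.mem_univ i)).trans (le_add_of_nonneg_right (by positivity))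
  refine ⟨fun i => ?_, ?_, ?_⟩
  · have hx : Tendsto (fun m => x (φ m) i.castSucc) l (𝓝 q.1) := by
      have hsub (m) : x (φ m) i.castSucc
          = z (φ m) - τ • (y (φ m) i.castSucc - w (φ m) i.castSucc) := by
        rw [smul_sub, eq_sub_iff_add_eq, ← add_sub_assoc, h.x_add_smul_y hτ, add_sub_cancel_right]
      simpa [hsub] using hz.sub ((hyw i).const_smul τ)
    refine (hA i).mem_of_tendsto (fun m => h.y_mem hτ (φ m) i) hx ?_
    simpa using (hyw i).add (hw i.castSucc)
  · have hBw : Tendsto (fun m => B (z (φ m)) - w (φ m) (Fin.last n)) l (𝓝 0) :=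
      hzero fun m => le_add_of_nonneg_left (by positivity)
    exact (sub_eq_zero.1
      (tendsto_nhds_unique (((hB.tendsto _).comp hz).sub (hw _)) hBw)).symm
  · refine tendsto_nhds_unique (tendsto_finsetSum _ fun i _ => hw i) ?_
    simp [h.sum_w_eq_zero]

theorem IsRun.exists_mem_extendedSolutionSet_mapClusterPt (h : IsRun A B τ α ρ ε e z w x y)
    (hτ : τ ≠ 0) (hA : ∀ i, IsMaximalMonotone (A i)) (hB : Continuous B) {b : ℕ → ℝ}
    (hb : ∀ k, 0 ≤ b k) (hdiv : ¬ Summable b)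
    (hres : Summable fun k => b k * residual B (z k) (w k) (y k))
    (hbdd : Bornology.IsBounded (Set.range fun k => (z k, w k))) :
    ∃ p ∈ extendedSolutionSet A B, MapClusterPt p atTop fun k => (z k, w k) := by
  obtain ⟨φ, hφ, hresφ⟩ := (mapClusterPt_zero_of_summable_mul hb
    (fun k => residual_nonneg B (z k) (w k) (y k)) hdiv hres).tendsto_subseq
  obtain ⟨p, -, ψ, hψ, hlim⟩ := tendsto_subseq_of_bounded hbdd fun m => Set.mem_range_self (φ m)
  exact ⟨p, h.mem_extendedSolutionSet_of_tendsto hτ hA hB (hresφ.comp hψ.tendsto_atTop) hlim,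
    hlim.mapClusterPt.of_comp (hφ.comp hψ).tendsto_atTop⟩

end Run

section AlmostSupermartingale

variable {Ω : Type*} {m0 : MeasurableSpace Ω} {μ : Measure Ω} {ℱ : Filtration ℕ m0}

theorem exists_ae_tendsto_of_supermartingale_of_nonneg [IsFiniteMeasure μ] {X : ℕ → Ω → ℝ}
    (hX : Supermartingale X ℱ μ) (hnonneg : ∀ k ω, 0 ≤ X k ω) :
    ∀ᵐ ω ∂μ, ∃ c, Tendsto (fun k => X k ω) atTop (𝓝 c) := by
  have hbdd (k : ℕ) : eLpNorm ((-X) k) 1 μ ≤ ((∫ ω, X 0 ω ∂μ).toNNReal : ℝ≥0) := by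
    have hle : ∫ ω, X k ω ∂μ ≤ ∫ ω, X 0 ω ∂μ := by
      simpa using hX.setIntegral_le (Nat.zero_le k) (s := Set.univ) MeasurableSet.univ
    rw [Pi.neg_apply, eLpNorm_neg, eLpNorm_one_eq_lintegral_enorm,
      ← ofReal_integral_norm_eq_lintegral_enorm (hX.integrable k)]
    simp only [Real.norm_of_nonneg (hnonneg k _)]
    exact ENNReal.ofReal_le_ofReal hle
  filter_upwards [hX.neg.exists_ae_tendsto_of_bdd hbdd] with ω ⟨c, hc⟩
  exact ⟨-c, by simpa using hc.neg⟩

/-- The accumulated growth factor `∏ j < k, (1 + a j)`, by which an almost supermartingale with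
growth rates `a` is discounted. -/
noncomputable def growthFactor (a : ℕ → ℝ) (k : ℕ) : ℝ := ∏ j ∈ Finset.range k, (1 + a j)

section Deterministic

variable {a : ℕ → ℝ}

theorem growthFactor_succ (a : ℕ → ℝ) (k : ℕ) :
    growthFactor a (k + 1) = growthFactor a k * (1 + a k) :=
  Finset.prod_range_succ _ _

theorem growthFactor_pos (ha : ∀ k, 0 ≤ a k) (k : ℕ) : 0 < growthFactor a k :=
  Finset.prod_pos fun j _ => by linarith [ha j]

theorem monotone_growthFactor (ha : ∀ k, 0 ≤ a k) : Monotone (growthFactor a) :=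
  monotone_nat_of_le_succ fun k => by
    rw [growthFactor_succ]
    exact le_mul_of_one_le_right (growthFactor_pos ha k).le (by linarith [ha k])

theorem growthFactor_le_exp_tsum (ha : ∀ k, 0 ≤ a k) (hsum : Summable a) (k : ℕ) :
    growthFactor a k ≤ Real.exp (∑' j, a j) :=
  (Real.prod_one_add_le_exp_sum _ ha).trans
    (Real.exp_le_exp.2 (hsum.sum_le_tsum _ fun j _ => ha j))

theorem exists_tendsto_and_summable_of_tendsto_discounted {u g : ℕ → ℝ} {c : ℝ}
    (ha : ∀ k, 0 ≤ a k) (hsum : Summable a) (hu : ∀ k, 0 ≤ u k) (hg : ∀ k, 0 ≤ g k)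
    (h : Tendsto (fun k => u k / growthFactor a k
      + ∑ j ∈ Finset.range k, g j / growthFactor a (j + 1)) atTop (𝓝 c)) :
    (∃ c, Tendsto u atTop (𝓝 c)) ∧ Summable g := by
  have hP (k : ℕ) : 0 < growthFactor a k := growthFactor_pos ha k
  have hPlim : Tendsto (growthFactor a) atTop (𝓝 (⨆ k, growthFactor a k)) :=
    tendsto_atTop_ciSup (monotone_growthFactor ha)
      ⟨_, Set.forall_mem_range.2 (growthFactor_le_exp_tsum ha hsum)⟩
  have hgP_nonneg (j : ℕ) : 0 ≤ g j / growthFactor a (j + 1) := div_nonneg (hg j) (hP _).le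
  have hgP : Summable fun j => g j / growthFactor a (j + 1) := by
    obtain ⟨M, hM⟩ := h.bddAbove_range
    exact summable_of_sum_range_le (c := M) hgP_nonneg fun k =>
      (le_add_of_nonneg_left (div_nonneg (hu k) (hP k).le)).trans (hM ⟨k, rfl⟩)
  constructor
  · refine ⟨_, ((h.sub hgP.hasSum.tendsto_sum_nat).mul hPlim).congr fun k => ?_⟩
    rw [add_sub_cancel_right, div_mul_cancel₀ _ (hP k).ne']
  · refine .of_nonneg_of_le hg (fun j => ?_) (hgP.mul_left (Real.exp (∑' j, a j)))
    calc g j = growthFactor a (j + 1) * (g j / growthFactor a (j + 1)) :=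
          (mul_div_cancel₀ _ (hP _).ne').symm
      _ ≤ Real.exp (∑' j, a j) * (g j / growthFactor a (j + 1)) :=
          mul_le_mul_of_nonneg_right (growthFactor_le_exp_tsum ha hsum _) (hgP_nonneg j)

end Deterministic

/-- A nonnegative process `U` that, up to the factors `1 + a k`, decreases in conditional mean by
at least the nonnegative losses `g k`. The inequality is required only on events on which `U k` is
bounded, and as an inequality of lower Lebesgue integrals, so that `U` need not be integrable. -/
structure IsAlmostSupermartingale (ℱ : Filtration ℕ m0) (μ : Measure Ω) (a : ℕ → ℝ)
    (U g : ℕ → Ω → ℝ) : Prop where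
  adapted : StronglyAdapted ℱ U
  adapted_loss : StronglyAdapted ℱ g
  nonneg : ∀ k ω, 0 ≤ U k ω
  loss_nonneg : ∀ k ω, 0 ≤ g k ω
  setLIntegral_succ_le_of_le : ∀ (k : ℕ) (s : Set Ω) (M : ℝ), MeasurableSet[ℱ k] s →
    (∀ ω ∈ s, U k ω ≤ M) → ∫⁻ ω in s, ENNReal.ofReal (U (k + 1) ω + g k ω) ∂μ
      ≤ ENNReal.ofReal (1 + a k) * ∫⁻ ω in s, ENNReal.ofReal (U k ω) ∂μ

namespace IsAlmostSupermartingale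

variable {a : ℕ → ℝ} {U g : ℕ → Ω → ℝ}

theorem measurableSet_le (h : IsAlmostSupermartingale ℱ μ a U g) (k : ℕ) (M : ℝ) :
    MeasurableSet[ℱ k] {ω | U k ω ≤ M} :=
  (h.adapted k).measurable measurableSet_Iic

theorem setLIntegral_succ_le (h : IsAlmostSupermartingale ℱ μ a U g) {k : ℕ} {s : Set Ω}
    (hs : MeasurableSet[ℱ k] s) :
    ∫⁻ ω in s, ENNReal.ofReal (U (k + 1) ω + g k ω) ∂μ
      ≤ ENNReal.ofReal (1 + a k) * ∫⁻ ω in s, ENNReal.ofReal (U k ω) ∂μ := by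
  have hunion : s = ⋃ M : ℕ, s ∩ {ω | U k ω ≤ M} := by
    rw [← Set.inter_iUnion, Set.inter_eq_left.2]
    exact fun ω _ => Set.mem_iUnion.2 (exists_nat_ge (U k ω))
  have hmono : Monotone fun M : ℕ => s ∩ {ω | U k ω ≤ M} := fun M M' hM =>
    Set.inter_subset_inter_right s fun ω (hω : U k ω ≤ M) => hω.trans (Nat.cast_le.2 hM)
  conv_lhs => rw [hunion, setLIntegral_iUnion_of_directed _ hmono.directed_le]
  refine iSup_le fun M => (h.setLIntegral_succ_le_of_le k _ M (hs.inter (h.measurableSet_le k M))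
    fun ω hω => hω.2).trans ?_
  gcongr
  exact Set.inter_subset_left

theorem restrict (h : IsAlmostSupermartingale ℱ μ a U g) {t : Set Ω}
    (ht : MeasurableSet[ℱ 0] t) : IsAlmostSupermartingale ℱ (μ.restrict t) a U g where
  adapted := h.adapted
  adapted_loss := h.adapted_loss
  nonneg := h.nonneg
  loss_nonneg := h.loss_nonneg
  setLIntegral_succ_le_of_le k s _ hs _ := by
    rw [Measure.restrict_restrict (ℱ.le k _ hs)]
    exact h.setLIntegral_succ_le (hs.inter (ℱ.mono (Nat.zero_le k) _ ht))

theorem integrable_succ_add (h : IsAlmostSupermartingale ℱ μ a U g) {k : ℕ}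
    (hint : Integrable (U k) μ) : Integrable (fun ω => U (k + 1) ω + g k ω) μ := by
  have hmeas : StronglyMeasurable fun ω => U (k + 1) ω + g k ω :=
    ((h.adapted _).mono (ℱ.le _)).add ((h.adapted_loss k).mono (ℱ.le k))
  refine (lintegral_ofReal_ne_top_iff_integrable hmeas.aestronglyMeasurable
    (ae_of_all _ fun ω => add_nonneg (h.nonneg _ _) (h.loss_nonneg _ _))).1 ?_
  have hle := h.setLIntegral_succ_le (k := k) MeasurableSet.univ
  rw [Measure.restrict_univ] at hle
  exact ne_top_of_le_ne_top
    (ENNReal.mul_ne_top ENNReal.ofReal_ne_top hint.lintegral_lt_top.ne) hle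

theorem integrable (h : IsAlmostSupermartingale ℱ μ a U g) (hint : Integrable (U 0) μ) (k : ℕ) :
    Integrable (U k) μ := by
  induction k with
  | zero => exact hint
  | succ k ih =>
    refine (h.integrable_succ_add ih).mono' ((h.adapted _).mono (ℱ.le _)).aestronglyMeasurable
      (ae_of_all _ fun ω => ?_)
    rw [Real.norm_of_nonneg (h.nonneg _ _)]
    exact le_add_of_nonneg_right (h.loss_nonneg k ω)

theorem integrable_loss (h : IsAlmostSupermartingale ℱ μ a U g) (hint : Integrable (U 0) μ)
    (k : ℕ) : Integrable (g k) μ :=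
  ((h.integrable_succ_add (h.integrable hint k)).sub (h.integrable hint (k + 1))).congr
    (ae_of_all _ fun _ => add_sub_cancel_left _ _)

theorem setIntegral_succ_add_le (h : IsAlmostSupermartingale ℱ μ a U g) (ha : ∀ k, 0 ≤ a k)
    (hint : Integrable (U 0) μ) {k : ℕ} {s : Set Ω} (hs : MeasurableSet[ℱ k] s) :
    ∫ ω in s, (U (k + 1) ω + g k ω) ∂μ ≤ (1 + a k) * ∫ ω in s, U k ω ∂μ := by
  have ha' : 0 ≤ 1 + a k := by linarith [ha k]
  rw [← ENNReal.ofReal_le_ofReal_iff (mul_nonneg ha' (integral_nonneg (h.nonneg k))),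
    ENNReal.ofReal_mul ha',
    ofReal_integral_eq_lintegral_ofReal (h.integrable_succ_add (h.integrable hint k)).integrableOn
      (ae_of_all _ fun ω => add_nonneg (h.nonneg _ _) (h.loss_nonneg _ _)),
    ofReal_integral_eq_lintegral_ofReal (h.integrable hint k).integrableOn
      (ae_of_all _ (h.nonneg k))]
  exact h.setLIntegral_succ_le hs

theorem supermartingale_discounted [IsFiniteMeasure μ] (h : IsAlmostSupermartingale ℱ μ a U g)
    (ha : ∀ k, 0 ≤ a k) (hint : Integrable (U 0) μ) :
    Supermartingale (fun k ω => U k ω / growthFactor a k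
      + ∑ j ∈ Finset.range k, g j ω / growthFactor a (j + 1)) ℱ μ := by
  have hintX (k : ℕ) : Integrable (fun ω => U k ω / growthFactor a k
      + ∑ j ∈ Finset.range k, g j ω / growthFactor a (j + 1)) μ :=
    ((h.integrable hint k).div_const _).add
      (integrable_finsetSum _ fun j _ => (h.integrable_loss hint j).div_const _)
  refine supermartingale_of_setIntegral_succ_le (fun k => ?_) hintX fun k s hs => ?_
  · exact ((h.adapted k).div stronglyMeasurable_const).add <|
      Finset.stronglyMeasurable_fun_sum _ fun j hj =>
        ((h.adapted_loss j).mono (ℱ.mono (Finset.mem_range.1 hj).le)).div stronglyMeasurable_const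
  · have hU := (h.integrable hint k).integrableOn (s := s)
    have hUg := (h.integrable_succ_add (h.integrable hint k)).integrableOn (s := s)
    have hP := growthFactor_pos ha (k + 1)
    have hincrement (ω : Ω) : U (k + 1) ω / growthFactor a (k + 1)
          + ∑ j ∈ Finset.range (k + 1), g j ω / growthFactor a (j + 1)
        = (U k ω / growthFactor a k + ∑ j ∈ Finset.range k, g j ω / growthFactor a (j + 1))
          + (U (k + 1) ω + g k ω - (1 + a k) * U k ω) / growthFactor a (k + 1) := by
      have hPk := (growthFactor_pos ha k).ne'
      have hak : 1 + a k ≠ 0 := by linarith [ha k]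
      rw [Finset.sum_range_succ, growthFactor_succ]
      field_simp
      ring
    simp only [hincrement]
    have hdiff : IntegrableOn (fun ω =>
        (U (k + 1) ω + g k ω - (1 + a k) * U k ω) / growthFactor a (k + 1)) s μ :=
      (hUg.sub (hU.const_mul _)).div_const _
    rw [integral_add (hintX k).integrableOn hdiff, integral_div,
      integral_sub hUg (hU.const_mul _), integral_const_mul]
    exact add_le_of_nonpos_right
      (div_nonpos_of_nonpos_of_nonneg (sub_nonpos.2 (h.setIntegral_succ_add_le ha hint hs)) hP.le)

theorem ae_exists_tendsto_and_summable_of_integrable [IsFiniteMeasure μ]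
    (h : IsAlmostSupermartingale ℱ μ a U g) (ha : ∀ k, 0 ≤ a k) (hsum : Summable a)
    (hint : Integrable (U 0) μ) :
    ∀ᵐ ω ∂μ, (∃ c, Tendsto (fun k => U k ω) atTop (𝓝 c)) ∧ Summable fun k => g k ω := by
  have hnonneg (k : ℕ) (ω : Ω) : 0 ≤ U k ω / growthFactor a k
      + ∑ j ∈ Finset.range k, g j ω / growthFactor a (j + 1) :=
    add_nonneg (div_nonneg (h.nonneg k ω) (growthFactor_pos ha k).le) <|
      Finset.sum_nonneg fun j _ => div_nonneg (h.loss_nonneg j ω) (growthFactor_pos ha _).le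
  filter_upwards [exists_ae_tendsto_of_supermartingale_of_nonneg
    (h.supermartingale_discounted ha hint) hnonneg] with ω ⟨_, hω⟩
  exact exists_tendsto_and_summable_of_tendsto_discounted ha hsum (h.nonneg · ω)
    (h.loss_nonneg · ω) hω

theorem ae_exists_tendsto_and_summable [IsFiniteMeasure μ]
    (h : IsAlmostSupermartingale ℱ μ a U g) (ha : ∀ k, 0 ≤ a k) (hsum : Summable a) :
    ∀ᵐ ω ∂μ, (∃ c, Tendsto (fun k => U k ω) atTop (𝓝 c)) ∧ Summable fun k => g k ω := by
  have hlevel (N : ℕ) : ∀ᵐ ω ∂μ, U 0 ω ≤ N →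
      (∃ c, Tendsto (fun k => U k ω) atTop (𝓝 c)) ∧ Summable fun k => g k ω := by
    have hmeas : MeasurableSet {ω | U 0 ω ≤ N} := ℱ.le 0 _ (h.measurableSet_le 0 N)
    refine (ae_restrict_iff' hmeas).1 <|
      (h.restrict (h.measurableSet_le 0 N)).ae_exists_tendsto_and_summable_of_integrable ha hsum <|
        .of_bound ((h.adapted 0).mono (ℱ.le 0)).aestronglyMeasurable (N : ℝ) <|
          (ae_restrict_iff' hmeas).2 (ae_of_all _ fun ω hω => ?_)
    rw [Real.norm_of_nonneg (h.nonneg 0 ω)]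
    exact hω
  filter_upwards [ae_all_iff.2 hlevel] with ω hω
  obtain ⟨N, hN⟩ := exists_nat_ge (U 0 ω)
  exact hω N hN

end IsAlmostSupermartingale

end AlmostSupermartingale

section ControlledNoise

variable {Ω E : Type*} [NormedAddCommGroup E] {m F G m0 : MeasurableSpace Ω} {μ : Measure Ω}
  {s : Set Ω}

theorem lintegral_ofReal_le_of_le_add_of_integral_eq_zero {h r c : Ω → ℝ}
    (hr : AEStronglyMeasurable r μ) (hr0 : ∀ ω, 0 ≤ r ω) (hc : Integrable c μ)
    (hc0 : ∫ ω, c ω ∂μ = 0) (hh0 : ∀ ω, 0 ≤ h ω) (hle : ∀ ω, h ω ≤ r ω + c ω) :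
    ∫⁻ ω, ENNReal.ofReal (h ω) ∂μ ≤ ∫⁻ ω, ENNReal.ofReal (r ω) ∂μ := by
  by_cases hfin : ∫⁻ ω, ENNReal.ofReal (r ω) ∂μ = ⊤
  · exact hfin ▸ le_top
  have hrint : Integrable r μ :=
    (lintegral_ofReal_ne_top_iff_integrable hr (ae_of_all _ hr0)).1 hfin
  calc ∫⁻ ω, ENNReal.ofReal (h ω) ∂μ ≤ ∫⁻ ω, ENNReal.ofReal (r ω + c ω) ∂μ :=
        lintegral_mono fun ω => ENNReal.ofReal_le_ofReal (hle ω)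
    _ = ENNReal.ofReal (∫ ω, (r ω + c ω) ∂μ) :=
        (ofReal_integral_eq_lintegral_ofReal (hrint.add hc)
          (ae_of_all _ fun ω => (hh0 ω).trans (hle ω))).symm
    _ = ENNReal.ofReal (∫ ω, r ω ∂μ) := by rw [integral_add hrint hc, hc0, add_zero]
    _ = ∫⁻ ω, ENNReal.ofReal (r ω) ∂μ :=
        ofReal_integral_eq_lintegral_ofReal hrint (ae_of_all _ hr0)

section Inner

variable [InnerProductSpace ℝ E] {f g : Ω → E} {M : ℝ}

theorem integrableOn_inner_of_norm_le (hs : MeasurableSet s) (hf : AEStronglyMeasurable f μ)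
    (hg : Integrable g μ) (hM : ∀ ω ∈ s, ‖f ω‖ ≤ M) :
    IntegrableOn (fun ω => inner ℝ (f ω) (g ω)) s μ := by
  refine (hg.norm.const_mul M).integrableOn.mono' (hf.inner hg.aestronglyMeasurable).restrict ?_
  filter_upwards [ae_restrict_mem hs] with ω hω
  exact (norm_inner_le_norm _ _).trans (by gcongr; exact hM ω hω)

theorem setIntegral_inner_eq_zero_of_condExp_eq_zero [CompleteSpace E] [IsFiniteMeasure μ]
    (hm : m ≤ m0) (hf : StronglyMeasurable[m] f) (hg : Integrable g μ) (hg0 : μ[g | m] =ᵐ[μ] 0)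
    (hs : MeasurableSet[m] s) (hM : ∀ ω ∈ s, ‖f ω‖ ≤ M) :
    ∫ ω in s, inner ℝ (f ω) (g ω) ∂μ = 0 := by
  have hindicator : (s.indicator fun ω => inner ℝ (f ω) (g ω))
      = fun ω => innerSL ℝ (s.indicator f ω) (g ω) := by
    ext ω
    by_cases hω : ω ∈ s <;> simp [hω]
  have hint := (integrable_indicator_iff (hm _ hs)).2
    (integrableOn_inner_of_norm_le (hm _ hs) (hf.mono hm).aestronglyMeasurable hg hM)
  rw [hindicator] at hint
  rw [← integral_indicator (hm _ hs), hindicator, ← integral_condExp hm, integral_eq_zero_of_ae]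
  filter_upwards [condExp_bilin_of_stronglyMeasurable_left (innerSL ℝ) (hf.indicator hs) hint hg,
    hg0] with ω hpull hω
  rw [hpull, hω]
  simp

end Inner

variable (F G μ) in
/-- A noise vector `ξ` that has mean zero given the σ-algebra `F`, and whose conditional second
moment given `G` grows at most like the squared norm of `B` at the evaluation point `v`. -/
structure IsControlledNoise [NormedSpace ℝ E] [CompleteSpace E] (N N' : ℝ) (B : E → E)
    (v ξ : Ω → E) : Prop where
  integrable : Integrable ξ μ
  condExp_eq_zero : μ[ξ | F] =ᵐ[μ] 0
  condLExp_le : ∀ᵐ ω ∂μ, condLExp G μ (fun ω' => ‖ξ ω'‖ₑ ^ 2) ω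
    ≤ ENNReal.ofReal (N + N' * ‖B (v ω)‖ ^ 2)

/-- The factor of `1 + ‖v - a‖ ^ 2` in the bound of a controlled noise with constants `N, N'`
evaluated at `v`, where `b` is the norm of `B a` and `L` is the Lipschitz constant of `B`. -/
noncomputable def noiseFactor (L : ℝ≥0) (N N' b : ℝ) : ℝ := N + N' * (2 * (L ^ 2 + b ^ 2))

theorem noiseFactor_nonneg (L : ℝ≥0) {N N' : ℝ} (hN : 0 ≤ N) (hN' : 0 ≤ N') (b : ℝ) :
    0 ≤ noiseFactor L N N' b := by
  unfold noiseFactor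
  positivity

variable {B : E → E} {L : ℝ≥0} {N N' : ℝ}

theorem add_mul_norm_sq_le_noiseFactor (hBlip : LipschitzWith L B) (hN : 0 ≤ N) (hN' : 0 ≤ N')
    (v a : E) :
    N + N' * ‖B v‖ ^ 2 ≤ noiseFactor L N N' ‖B a‖ * (1 + ‖v - a‖ ^ 2) := by
  have hB : ‖B v‖ ^ 2 ≤ 2 * (L ^ 2 + ‖B a‖ ^ 2) * (1 + ‖v - a‖ ^ 2) := by
    have hgrowth := norm_add_sub_sq_le hBlip v a (B a)
    rw [add_sub_cancel_right] at hgrowth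
    have : 0 ≤ 2 * ‖B a‖ ^ 2 * ‖v - a‖ ^ 2 + 2 * L ^ 2 := by positivity
    linarith
  rw [noiseFactor]
  linarith [mul_le_mul_of_nonneg_left hB hN', mul_nonneg hN (sq_nonneg ‖v - a‖)]

theorem IsControlledNoise.setLIntegral_enorm_sq_le [NormedSpace ℝ E] [CompleteSpace E]
    [IsFiniteMeasure μ] {v ξ : Ω → E} (h : IsControlledNoise F G μ N N' B v ξ) (hG : G ≤ m0)
    (hBlip : LipschitzWith L B) (hN : 0 ≤ N) (hN' : 0 ≤ N') (a : E) (hs : MeasurableSet[G] s) :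
    ∫⁻ ω in s, ‖ξ ω‖ₑ ^ 2 ∂μ ≤ ENNReal.ofReal (noiseFactor L N N' ‖B a‖)
      * ∫⁻ ω in s, ENNReal.ofReal (1 + ‖v ω - a‖ ^ 2) ∂μ := by
  rw [← setLIntegral_condLExp hG μ _ hs, ← lintegral_const_mul' _ _ ENNReal.ofReal_ne_top]
  refine lintegral_mono_ae (ae_restrict_of_ae ?_)
  filter_upwards [h.condLExp_le] with ω hω
  rw [← ENNReal.ofReal_mul (noiseFactor_nonneg L hN hN' _)]
  exact hω.trans (ENNReal.ofReal_le_ofReal (add_mul_norm_sq_le_noiseFactor hBlip hN hN' _ a))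

theorem lintegral_ofReal_add_mul_add_norm_sq_le [MeasurableSpace E] [OpensMeasurableSpace E]
    {U : Ω → ℝ} {ξ η : Ω → E} {a D D' : ℝ}
    (hU : Measurable U) (hU0 : ∀ ω, 0 ≤ U ω) (hξ : Measurable ξ) (ha : 0 ≤ a) (hD : 0 ≤ D)
    (hD' : 0 ≤ D')
    (hξ_le : ∫⁻ ω, ‖ξ ω‖ₑ ^ 2 ∂μ ≤ ENNReal.ofReal D * ∫⁻ ω, ENNReal.ofReal (U ω) ∂μ)
    (hη_le : ∫⁻ ω, ‖η ω‖ₑ ^ 2 ∂μ ≤ ENNReal.ofReal D'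
      * (∫⁻ ω, ENNReal.ofReal (U ω) ∂μ + ∫⁻ ω, ‖ξ ω‖ₑ ^ 2 ∂μ)) :
    ∫⁻ ω, ENNReal.ofReal (U ω + a * (U ω + ‖ξ ω‖ ^ 2 + ‖η ω‖ ^ 2)) ∂μ
      ≤ ENNReal.ofReal (1 + a * ((1 + D) * (1 + D'))) * ∫⁻ ω, ENNReal.ofReal (U ω) ∂μ := by
  set I := ∫⁻ ω, ENNReal.ofReal (U ω) ∂μ
  have hpoint (ω : Ω) : ENNReal.ofReal (U ω + a * (U ω + ‖ξ ω‖ ^ 2 + ‖η ω‖ ^ 2))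
      = ENNReal.ofReal (U ω) + ENNReal.ofReal a
        * (ENNReal.ofReal (U ω) + ‖ξ ω‖ₑ ^ 2 + ‖η ω‖ₑ ^ 2) := by
    have := hU0 ω
    rw [ENNReal.ofReal_add this (by positivity), ENNReal.ofReal_mul ha,
      ENNReal.ofReal_add (by positivity) (by positivity),
      ENNReal.ofReal_add this (by positivity)]
    simp only [ENNReal.ofReal_pow (norm_nonneg _), ofReal_norm]
  have hUm : Measurable fun ω => ENNReal.ofReal (U ω) := hU.ennreal_ofReal
  have hUξm : Measurable fun ω => ENNReal.ofReal (U ω) + ‖ξ ω‖ₑ ^ 2 := by fun_prop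
  calc ∫⁻ ω, ENNReal.ofReal (U ω + a * (U ω + ‖ξ ω‖ ^ 2 + ‖η ω‖ ^ 2)) ∂μ
      = I + ENNReal.ofReal a * (I + ∫⁻ ω, ‖ξ ω‖ₑ ^ 2 ∂μ + ∫⁻ ω, ‖η ω‖ₑ ^ 2 ∂μ) := by
        simp only [hpoint]
        rw [lintegral_add_left hUm, lintegral_const_mul' _ _ ENNReal.ofReal_ne_top,
          lintegral_add_left hUξm, lintegral_add_left hUm]
    _ ≤ I + ENNReal.ofReal a * (I + ENNReal.ofReal D * I
          + ENNReal.ofReal D' * (I + ENNReal.ofReal D * I)) := by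
        gcongr
        exact hη_le.trans (by gcongr)
    _ = (1 + ENNReal.ofReal a * ((1 + ENNReal.ofReal D) * (1 + ENNReal.ofReal D'))) * I := by
        ring
    _ = ENNReal.ofReal (1 + a * ((1 + D) * (1 + D'))) * I := by
        rw [ENNReal.ofReal_add zero_le_one (by positivity), ENNReal.ofReal_mul ha,
          ENNReal.ofReal_mul (by positivity), ENNReal.ofReal_add zero_le_one hD,
          ENNReal.ofReal_add zero_le_one hD', ENNReal.ofReal_one]

end ControlledNoise

section RandomRun

variable {d n : ℕ} {Ω : Type*} {A : Fin n → Vec d → Set (Vec d)} {B : Vec d → Vec d} {τ : ℝ}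
  {α ρ : ℕ → ℝ} {ε e z : ℕ → Ω → Vec d} {w x y : ℕ → Ω → Fin (n + 1) → Vec d}

theorem measurable_pastSigma (z : ℕ → Ω → Vec d) (w : ℕ → Ω → Fin (n + 1) → Vec d) (k : ℕ) :
    Measurable[pastSigma z w k] fun ω => (z k ω, w k ω) :=
  (comap_measurable _).mono (le_iSup₂_of_le k le_rfl le_rfl) le_rfl

theorem measurable_norm_toL2_sub_sq {mΩ : MeasurableSpace Ω} {z : Ω → Vec d}
    {w : Ω → Fin (n + 1) → Vec d} (h : Measurable fun ω => (z ω, w ω))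
    (q : Vec d × (Fin (n + 1) → Vec d)) :
    Measurable fun ω => ‖toL2 ((z ω, w ω) - q)‖ ^ 2 := by
  have hz : Measurable z := measurable_fst.comp h
  have hw : Measurable w := measurable_snd.comp h
  simp only [norm_toL2_sq, Prod.fst_sub, Prod.snd_sub, Pi.sub_apply]
  fun_prop

section Deterministic

variable (h : ∀ ω, IsRun A B τ α ρ (fun k => ε k ω) (fun k => e k ω)
  (fun k => z k ω) (fun k => w k ω) (fun k => x k ω) (fun k => y k ω))
include h

theorem measurable_resolvent_block {m : MeasurableSpace Ω} (hA : ∀ i, IsMonotoneOp (A i))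
    (hτ : 0 ≤ τ) {k : ℕ} (hk : Measurable fun ω => (z k ω, w k ω)) (i : Fin n) :
    Measurable (fun ω => x k ω i.castSucc) ∧ Measurable (fun ω => y k ω i.castSucc) := by
  obtain ⟨J, hJ, hxJ⟩ := (hA i).exists_continuous_resolvent hτ
  have hz : Measurable (z k) := measurable_fst.comp hk
  have hw : Measurable (w k) := measurable_snd.comp hk
  have hx : Measurable fun ω => x k ω i.castSucc := by
    have hJm := hJ.measurable
    simp only [fun ω => hxJ _ _ ((h ω).x_resolvent k i)]
    fun_prop
  refine ⟨hx, ?_⟩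
  simp only [fun ω => (h ω).y_resolvent k i]
  fun_prop

theorem measurable_forward_block {m : MeasurableSpace Ω} (hB : Measurable B) {k : ℕ}
    (hk : Measurable fun ω => (z k ω, w k ω)) (hε : Measurable (ε k)) (he : Measurable (e k)) :
    Measurable (fun ω => x k ω (Fin.last n)) ∧ Measurable (fun ω => y k ω (Fin.last n)) := by
  have hz : Measurable (z k) := measurable_fst.comp hk
  have hw : Measurable (w k) := measurable_snd.comp hk
  have hx : Measurable fun ω => x k ω (Fin.last n) := by
    simp only [fun ω => (h ω).x_last k]
    fun_prop
  refine ⟨hx, ?_⟩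
  simp only [fun ω => (h ω).y_last k]
  fun_prop

theorem measurable_iterate_succ {m : MeasurableSpace Ω} (hA : ∀ i, IsMonotoneOp (A i))
    (hτ : 0 ≤ τ) (hB : Measurable B) {k : ℕ} (hk : Measurable fun ω => (z k ω, w k ω))
    (hε : Measurable (ε k)) (he : Measurable (e k)) :
    Measurable fun ω => (z (k + 1) ω, w (k + 1) ω) := by
  have hforward := measurable_forward_block h hB hk hε he
  have hresolvent := measurable_resolvent_block h hA hτ hk
  have hx (i) : Measurable fun ω => x k ω i :=
    Fin.lastCases hforward.1 (fun i => (hresolvent i).1) i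
  have hy (i) : Measurable fun ω => y k ω i :=
    Fin.lastCases hforward.2 (fun i => (hresolvent i).2) i
  simp only [fun ω => (h ω).succ_eq k, separatorGradient]
  fun_prop

theorem measurable_residual {m : MeasurableSpace Ω} (hA : ∀ i, IsMonotoneOp (A i))
    (hτ : 0 ≤ τ) (hB : Measurable B) {k : ℕ} (hk : Measurable fun ω => (z k ω, w k ω)) :
    Measurable fun ω => residual B (z k ω) (w k ω) (y k ω) := by
  have hz : Measurable (z k) := measurable_fst.comp hk
  have hw : Measurable (w k) := measurable_snd.comp hk
  have hy (i : Fin n) := (measurable_resolvent_block h hA hτ hk i).2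
  unfold residual
  fun_prop

end Deterministic

/-- The natural filtration of the primal-dual iterates. -/
def pastFiltration [m0 : MeasurableSpace Ω] (h : ∀ k, Measurable fun ω => (z k ω, w k ω)) :
    Filtration ℕ m0 where
  seq := pastSigma z w
  mono' _ _ hkl := iSup₂_le fun j hj => le_iSup₂_of_le j (hj.trans hkl) le_rfl
  le' _ := iSup₂_le fun j _ => (h j).comap_le

/-- A run of stochastic projective splitting in which the initial point and the noise vectors are
random vectors. -/
structure IsRandomRun [MeasurableSpace Ω] (A : Fin n → Vec d → Set (Vec d)) (B : Vec d → Vec d)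
    (τ : ℝ) (α ρ : ℕ → ℝ) (ε e z : ℕ → Ω → Vec d) (w x y : ℕ → Ω → Fin (n + 1) → Vec d) :
    Prop where
  isRun : ∀ ω, IsRun A B τ α ρ (fun k => ε k ω) (fun k => e k ω)
    (fun k => z k ω) (fun k => w k ω) (fun k => x k ω) (fun k => y k ω)
  measurable_zero : Measurable fun ω => (z 0 ω, w 0 ω)
  measurable_ε : ∀ k, Measurable (ε k)
  measurable_e : ∀ k, Measurable (e k)

theorem IsRandomRun.measurable_iterate [MeasurableSpace Ω]
    (h : IsRandomRun A B τ α ρ ε e z w x y) (hA : ∀ i, IsMonotoneOp (A i)) (hτ : 0 ≤ τ)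
    (hB : Measurable B) (k : ℕ) : Measurable fun ω => (z k ω, w k ω) := by
  induction k with
  | zero => exact h.measurable_zero
  | succ k ih =>
    exact measurable_iterate_succ h.isRun hA hτ hB ih (h.measurable_ε k) (h.measurable_e k)

end RandomRun

theorem norm_fst_sub_sq_add_norm_last_sub_sq_le {d n : ℕ} {A : Fin n → Vec d → Set (Vec d)}
    {B : Vec d → Vec d} {q : Vec d × (Fin (n + 1) → Vec d)} (hq : q ∈ extendedSolutionSet A B)
    (z : Vec d) (w : Fin (n + 1) → Vec d) :
    ‖z - q.1‖ ^ 2 + ‖w (Fin.last n) - B q.1‖ ^ 2 ≤ ‖toL2 ((z, w) - q)‖ ^ 2 := by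
  rw [← hq.2.1]
  exact norm_fst_sq_add_norm_snd_sq_le ((z, w) - q) (Fin.last n)

section Step

variable {d n : ℕ} {Ω : Type*} {m F G m0 : MeasurableSpace Ω} {μ : Measure Ω} [IsFiniteMeasure μ]
  {A : Fin n → Vec d → Set (Vec d)} {B : Vec d → Vec d} {L : ℝ≥0} {N₁ N₂ N₃ N₄ M : ℝ}
  {q : Vec d × (Fin (n + 1) → Vec d)} {s : Set Ω}

theorem integrableOn_and_setIntegral_crossTerm_eq_zero {z ε e v v' : Ω → Vec d}
    {w : Ω → Fin (n + 1) → Vec d} (hm : m ≤ m0)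
    (hzw : Measurable[m] fun ω => (z ω, w ω)) (hBlip : LipschitzWith L B)
    (hε : IsControlledNoise m F μ N₁ N₂ B v ε) (he : IsControlledNoise m G μ N₃ N₄ B v' e)
    (hq : q ∈ extendedSolutionSet A B) (hs : MeasurableSet[m] s)
    (hM : ∀ ω ∈ s, ‖toL2 ((z ω, w ω) - q)‖ ^ 2 ≤ M) (b t : ℝ) :
    IntegrableOn (fun ω => b * (inner ℝ (z ω - q.1) (e ω)
        + t * inner ℝ (B (z ω) - w ω (Fin.last n)) (ε ω))) s μ ∧
      ∫ ω in s, b * (inner ℝ (z ω - q.1) (e ω)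
        + t * inner ℝ (B (z ω) - w ω (Fin.last n)) (ε ω)) ∂μ = 0 := by
  have hz : Measurable[m] z := measurable_fst.comp hzw
  have hw : Measurable[m] w := measurable_snd.comp hzw
  have hBm : Measurable B := hBlip.continuous.measurable
  have hprimal : StronglyMeasurable[m] fun ω => z ω - q.1 :=
    (hz.sub_const q.1).stronglyMeasurable
  have hdual : StronglyMeasurable[m] fun ω => B (z ω) - w ω (Fin.last n) :=
    ((hBm.comp hz).sub ((measurable_pi_apply (Fin.last n)).comp hw)).stronglyMeasurable
  have hcoord (ω : Ω) := norm_fst_sub_sq_add_norm_last_sub_sq_le hq (z ω) (w ω)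
  have hprimal_le : ∀ ω ∈ s, ‖z ω - q.1‖ ≤ √M := fun ω hω =>
    Real.le_sqrt_of_sq_le (by linarith [hM ω hω, hcoord ω, sq_nonneg ‖w ω (Fin.last n) - B q.1‖])
  have hdual_le : ∀ ω ∈ s, ‖B (z ω) - w ω (Fin.last n)‖ ≤ √(2 * (L ^ 2 + 1) * M) := by
    refine fun ω hω => Real.le_sqrt_of_sq_le ?_
    have hlip := norm_add_sub_sq_le hBlip (z ω) q.1 (B q.1 - w ω (Fin.last n))
    rw [add_sub_right_comm, sub_add_sub_cancel, norm_sub_rev (B q.1)] at hlip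
    nlinarith [hM ω hω, hcoord ω, sq_nonneg ‖z ω - q.1‖, sq_nonneg ‖w ω (Fin.last n) - B q.1‖]
  have hint_e := integrableOn_inner_of_norm_le (hm _ hs)
    (hprimal.mono hm).aestronglyMeasurable he.integrable hprimal_le
  have hint_ε := integrableOn_inner_of_norm_le (hm _ hs)
    (hdual.mono hm).aestronglyMeasurable hε.integrable hdual_le
  refine ⟨(hint_e.add (hint_ε.const_mul t)).const_mul b, ?_⟩
  rw [integral_const_mul, integral_add hint_e (hint_ε.const_mul t), integral_const_mul,
    setIntegral_inner_eq_zero_of_condExp_eq_zero hm hprimal he.integrable he.condExp_eq_zero hs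
      hprimal_le,
    setIntegral_inner_eq_zero_of_condExp_eq_zero hm hdual hε.integrable hε.condExp_eq_zero hs
      hdual_le]
  ring

end Step

section Convergence

variable {d n : ℕ} {Ω : Type*} {F G : MeasurableSpace Ω} [m0 : MeasurableSpace Ω] {μ : Measure Ω}
  [IsFiniteMeasure μ] {A : Fin n → Vec d → Set (Vec d)} {B : Vec d → Vec d} {τ : ℝ} {L : ℝ≥0}
  {α ρ : ℕ → ℝ} {ρbar c N₁ N₂ N₃ N₄ M : ℝ} {ε e z : ℕ → Ω → Vec d} {v v' : Ω → Vec d}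
  {w x y : ℕ → Ω → Fin (n + 1) → Vec d} {q : Vec d × (Fin (n + 1) → Vec d)} {s : Set Ω}

theorem setLIntegral_enorm_ε_sq_le {k : ℕ} (hk : pastSigma z w k ≤ m0)
    (hBlip : LipschitzWith L B) (hN₁ : 0 ≤ N₁) (hN₂ : 0 ≤ N₂)
    (hε : IsControlledNoise (pastSigma z w k) (pastSigma z w k) μ N₁ N₂ B (z k) (ε k))
    (hs : MeasurableSet[pastSigma z w k] s) :
    ∫⁻ ω in s, ‖ε k ω‖ₑ ^ 2 ∂μ ≤ ENNReal.ofReal (noiseFactor L N₁ N₂ ‖B q.1‖)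
      * ∫⁻ ω in s, ENNReal.ofReal (1 + ‖toL2 ((z k ω, w k ω) - q)‖ ^ 2) ∂μ := by
  have hcoord (ω : Ω) : ‖z k ω - q.1‖ ^ 2 ≤ ‖toL2 ((z k ω, w k ω) - q)‖ ^ 2 :=
    (le_add_of_nonneg_right (sq_nonneg _)).trans
      (norm_fst_sq_add_norm_snd_sq_le ((z k ω, w k ω) - q) (Fin.last n))
  exact (hε.setLIntegral_enorm_sq_le hk hBlip hN₁ hN₂ q.1 hs).trans <| mul_le_mul' le_rfl <|
    lintegral_mono fun ω => ENNReal.ofReal_le_ofReal (add_le_add_right (hcoord ω) 1)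

/-- The factor of the squared distance of the current iterate to an extended solution and of
`‖ε‖ ^ 2` in the bound of the conditional second moment of the noise `e`. -/
noncomputable def forwardNoiseFactor (L : ℝ≥0) (ρbar N₃ N₄ b : ℝ) : ℝ :=
  noiseFactor L N₃ N₄ b * (1 + 3 * ((1 + ρbar * L) ^ 2 + ρbar ^ 2))

theorem forwardNoiseFactor_nonneg (L : ℝ≥0) (ρbar : ℝ) (hN₃ : 0 ≤ N₃) (hN₄ : 0 ≤ N₄) (b : ℝ) :
    0 ≤ forwardNoiseFactor L ρbar N₃ N₄ b :=
  mul_nonneg (noiseFactor_nonneg L hN₃ hN₄ b) (by positivity)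

theorem setLIntegral_enorm_e_sq_le (h : IsRandomRun A B τ α ρ ε e z w x y) {k : ℕ}
    (hk : pastSigma z w k ≤ m0) (hBlip : LipschitzWith L B) (hρ : ∀ k, 0 ≤ ρ k)
    (hρbar : ∀ k, ρ k ≤ ρbar) (hN₃ : 0 ≤ N₃) (hN₄ : 0 ≤ N₄)
    (he : IsControlledNoise (pastSigma z w k) (pastSigma z w k ⊔ noiseSigma (ε k)) μ N₃ N₄ B
      (fun ω => x k ω (Fin.last n)) (e k))
    (hq : q ∈ extendedSolutionSet A B) (hs : MeasurableSet[pastSigma z w k] s) :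
    ∫⁻ ω in s, ‖e k ω‖ₑ ^ 2 ∂μ ≤ ENNReal.ofReal (forwardNoiseFactor L ρbar N₃ N₄ ‖B q.1‖)
      * (∫⁻ ω in s, ENNReal.ofReal (1 + ‖toL2 ((z k ω, w k ω) - q)‖ ^ 2) ∂μ
        + ∫⁻ ω in s, ‖ε k ω‖ₑ ^ 2 ∂μ) := by
  have hmoment := he.setLIntegral_enorm_sq_le (sup_le hk (h.measurable_ε k).comap_le) hBlip hN₃ hN₄
    q.1 (le_sup_left (b := noiseSigma (ε k)) _ hs)
  set K := 1 + 3 * ((1 + ρbar * L) ^ 2 + ρbar ^ 2) with hK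
  have hx (ω : Ω) : 1 + ‖x k ω (Fin.last n) - q.1‖ ^ 2
      ≤ K * ((1 + ‖toL2 ((z k ω, w k ω) - q)‖ ^ 2) + ‖ε k ω‖ ^ 2) := by
    have hforward := norm_forward_step_sub_sq_le hBlip (hρ k) (hρbar k) ((h.isRun ω).x_last k) q.1
    have hcoord := mul_le_mul_of_nonneg_left
      (norm_fst_sub_sq_add_norm_last_sub_sq_le hq (z k ω) (w k ω))
      (show 0 ≤ 3 * ((1 + ρbar * L) ^ 2 + ρbar ^ 2) by positivity)
    have : 0 ≤ 3 * ((1 + ρbar * L) ^ 2 + ρbar ^ 2) := by positivity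
    rw [hK]
    linarith [sq_nonneg ‖toL2 ((z k ω, w k ω) - q)‖, sq_nonneg ‖ε k ω‖]
  have hV : Measurable fun ω => ENNReal.ofReal (1 + ‖toL2 ((z k ω, w k ω) - q)‖ ^ 2) :=
    ((measurable_norm_toL2_sub_sq ((measurable_pastSigma z w k).mono hk le_rfl) q).const_add
      1).ennreal_ofReal
  rw [forwardNoiseFactor, ENNReal.ofReal_mul (noiseFactor_nonneg L hN₃ hN₄ _), mul_assoc,
    ← lintegral_add_left hV, ← lintegral_const_mul' _ _ ENNReal.ofReal_ne_top]
  refine hmoment.trans ?_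
  gcongr with ω
  rw [← ofReal_norm, ← ENNReal.ofReal_pow (norm_nonneg _),
    ← ENNReal.ofReal_add (by positivity) (by positivity), ← ENNReal.ofReal_mul (by positivity)]
  exact ENNReal.ofReal_le_ofReal (hx ω)

theorem exists_pos_mul_le_and_le_one_sub {τ ρbar L : ℝ} (hτ : 0 < τ) (hρbar : 0 ≤ ρbar)
    (hL : ρbar * L < 1) : ∃ c > 0, c * ρbar ≤ τ ∧ c ≤ 1 - ρbar * L := by
  refine ⟨min (τ / (ρbar + 1)) (1 - ρbar * L), lt_min (by positivity) (sub_pos.2 hL), ?_,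
    min_le_right _ _⟩
  calc min (τ / (ρbar + 1)) (1 - ρbar * L) * ρbar ≤ τ / (ρbar + 1) * (ρbar + 1) := by
        gcongr
        · exact min_le_left _ _
        · linarith
    _ = τ := div_mul_cancel₀ _ (by positivity)

theorem setLIntegral_add_residual_le (h : IsRandomRun A B τ α ρ ε e z w x y) {k : ℕ}
    (hk : pastSigma z w k ≤ m0) (hτ : 0 < τ) (hA : ∀ i, IsMonotoneOp (A i))
    (hBlip : LipschitzWith L B) (hBmono : ∀ u v, 0 ≤ inner ℝ (B u - B v) (u - v))
    (hα : ∀ k, 0 ≤ α k) (hρ : ∀ k, 0 ≤ ρ k) (hρbar : ∀ k, ρ k ≤ ρbar) (hc : 0 ≤ c)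
    (hcτ : c * ρbar ≤ τ) (hcL : c ≤ 1 - ρbar * L)
    (hε : IsControlledNoise (pastSigma z w k) F μ N₁ N₂ B v (ε k))
    (he : IsControlledNoise (pastSigma z w k) G μ N₃ N₄ B v' (e k))
    (hq : q ∈ extendedSolutionSet A B) (hs : MeasurableSet[pastSigma z w k] s)
    (hM : ∀ ω ∈ s, ‖toL2 ((z k ω, w k ω) - q)‖ ^ 2 ≤ M) :
    ∫⁻ ω in s, ENNReal.ofReal (1 + ‖toL2 ((z (k + 1) ω, w (k + 1) ω) - q)‖ ^ 2
        + 2 * c * (α k * ρ k * residual B (z k ω) (w k ω) (y k ω))) ∂μ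
      ≤ ∫⁻ ω in s, ENNReal.ofReal (1 + ‖toL2 ((z k ω, w k ω) - q)‖ ^ 2
        + stepError n L τ ρbar (α k) (ρ k)
          * (1 + ‖toL2 ((z k ω, w k ω) - q)‖ ^ 2 + ‖ε k ω‖ ^ 2 + ‖e k ω‖ ^ 2)) ∂μ := by
  have hV : Measurable fun ω => 1 + ‖toL2 ((z k ω, w k ω) - q)‖ ^ 2 :=
    (measurable_norm_toL2_sub_sq ((measurable_pastSigma z w k).mono hk le_rfl) q).const_add 1
  have hεm := (h.measurable_ε k).norm.pow_const 2
  have hem := (h.measurable_e k).norm.pow_const 2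
  have hstep := stepError_nonneg n L τ ρbar (ρ k) (hα k)
  obtain ⟨hcross, hcross0⟩ := integrableOn_and_setIntegral_crossTerm_eq_zero hk
    (measurable_pastSigma z w k) hBlip hε he hq hs hM (-(2 * α k)) (ρ k - 2 * L * ρ k ^ 2)
  refine lintegral_ofReal_le_of_le_add_of_integral_eq_zero
    (hV.add (((hV.add hεm).add hem).const_mul _)).aestronglyMeasurable
    (fun ω => by positivity) hcross hcross0 (fun ω => ?_) fun ω => ?_
  · have := mul_nonneg (mul_nonneg (hα k) (hρ k))
      (residual_nonneg B (z k ω) (w k ω) (y k ω))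
    positivity
  · have hdescent := (h.isRun ω).norm_toL2_sub_sq_succ_le hτ hA hBlip hBmono hα hρ hρbar hc hcτ
      hcL hq k
    linarith

theorem isAlmostSupermartingale_one_add_norm_toL2_sub_sq
    (h : IsRandomRun A B τ α ρ ε e z w x y) (hτ : 0 < τ) (hA : ∀ i, IsMonotoneOp (A i))
    (hBlip : LipschitzWith L B) (hBmono : ∀ u v, 0 ≤ inner ℝ (B u - B v) (u - v))
    (hα : ∀ k, 0 ≤ α k) (hρ : ∀ k, 0 ≤ ρ k) (hρbar : ∀ k, ρ k ≤ ρbar) (hc : 0 ≤ c)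
    (hcτ : c * ρbar ≤ τ) (hcL : c ≤ 1 - ρbar * L)
    (hN₁ : 0 ≤ N₁) (hN₂ : 0 ≤ N₂) (hN₃ : 0 ≤ N₃) (hN₄ : 0 ≤ N₄)
    (hε : ∀ k, IsControlledNoise (pastSigma z w k) (pastSigma z w k) μ N₁ N₂ B (z k) (ε k))
    (he : ∀ k, IsControlledNoise (pastSigma z w k) (pastSigma z w k ⊔ noiseSigma (ε k)) μ N₃ N₄ B
      (fun ω => x k ω (Fin.last n)) (e k))
    (hq : q ∈ extendedSolutionSet A B) :
    IsAlmostSupermartingale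
      (pastFiltration (h.measurable_iterate hA hτ.le hBlip.continuous.measurable)) μ
      (fun k => stepError n L τ ρbar (α k) (ρ k) * ((1 + noiseFactor L N₁ N₂ ‖B q.1‖)
        * (1 + forwardNoiseFactor L ρbar N₃ N₄ ‖B q.1‖)))
      (fun k ω => 1 + ‖toL2 ((z k ω, w k ω) - q)‖ ^ 2)
      (fun k ω => 2 * c * (α k * ρ k * residual B (z k ω) (w k ω) (y k ω))) where
  adapted k := ((measurable_norm_toL2_sub_sq (measurable_pastSigma z w k) q).const_add
    1).stronglyMeasurable
  adapted_loss k := (((measurable_residual h.isRun hA hτ.le hBlip.continuous.measurable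
    (measurable_pastSigma z w k)).const_mul _).const_mul _).stronglyMeasurable
  nonneg k ω := by positivity
  loss_nonneg k ω := mul_nonneg (by positivity)
    (mul_nonneg (mul_nonneg (hα k) (hρ k)) (residual_nonneg B _ _ _))
  setLIntegral_succ_le_of_le k s M hs hM := by
    have hk : pastSigma z w k ≤ m0 :=
      (pastFiltration (h.measurable_iterate hA hτ.le hBlip.continuous.measurable)).le k
    have hV := measurable_norm_toL2_sub_sq ((measurable_pastSigma z w k).mono hk le_rfl) q
    exact (setLIntegral_add_residual_le h hk hτ hA hBlip hBmono hα hρ hρbar hc hcτ hcL (hε k)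
      (he k) hq hs fun ω hω => (le_add_of_nonneg_left zero_le_one).trans (hM ω hω)).trans <|
      lintegral_ofReal_add_mul_add_norm_sq_le (hV.const_add 1) (fun ω => by positivity)
        (h.measurable_ε k)
        (stepError_nonneg n L τ ρbar (ρ k) (hα k)) (noiseFactor_nonneg L hN₁ hN₂ _)
        (forwardNoiseFactor_nonneg L ρbar hN₃ hN₄ _)
        (setLIntegral_enorm_ε_sq_le hk hBlip hN₁ hN₂ (hε k) hs)
        (setLIntegral_enorm_e_sq_le h hk hBlip hρ hρbar hN₃ hN₄ (he k) hq hs)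

theorem ae_exists_tendsto_norm_toL2_sub_and_summable_residual
    (h : IsRandomRun A B τ α ρ ε e z w x y) (hτ : 0 < τ) (hA : ∀ i, IsMonotoneOp (A i))
    (hBlip : LipschitzWith L B) (hBmono : ∀ u v, 0 ≤ inner ℝ (B u - B v) (u - v))
    (hα : ∀ k, 0 ≤ α k) (hρ : ∀ k, 0 ≤ ρ k) (hα2 : Summable fun k => α k ^ 2)
    (hαρ2 : Summable fun k => α k * ρ k ^ 2) (hρbar : ∀ k, ρ k ≤ ρbar) (hρbarL : ρbar * L < 1)
    (hN₁ : 0 ≤ N₁) (hN₂ : 0 ≤ N₂) (hN₃ : 0 ≤ N₃) (hN₄ : 0 ≤ N₄)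
    (hε : ∀ k, IsControlledNoise (pastSigma z w k) (pastSigma z w k) μ N₁ N₂ B (z k) (ε k))
    (he : ∀ k, IsControlledNoise (pastSigma z w k) (pastSigma z w k ⊔ noiseSigma (ε k)) μ N₃ N₄ B
      (fun ω => x k ω (Fin.last n)) (e k))
    (hq : q ∈ extendedSolutionSet A B) :
    ∀ᵐ ω ∂μ, (∃ r, Tendsto (fun k => dist (toL2 (z k ω, w k ω)) (toL2 q)) atTop (𝓝 r)) ∧
      Summable fun k => α k * ρ k * residual B (z k ω) (w k ω) (y k ω) := by
  obtain ⟨c, hc, hcτ, hcL⟩ := exists_pos_mul_le_and_le_one_sub hτ ((hρ 0).trans (hρbar 0)) hρbarL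
  have hsupermartingale := isAlmostSupermartingale_one_add_norm_toL2_sub_sq h hτ hA hBlip
    hBmono hα hρ hρbar hc.le hcτ hcL hN₁ hN₂ hN₃ hN₄ hε he hq
  filter_upwards [hsupermartingale.ae_exists_tendsto_and_summable
    (fun k => mul_nonneg (stepError_nonneg n L τ ρbar (ρ k) (hα k))
      (mul_nonneg (add_nonneg zero_le_one (noiseFactor_nonneg L hN₁ hN₂ _))
        (add_nonneg zero_le_one (forwardNoiseFactor_nonneg L ρbar hN₃ hN₄ _))))
    ((summable_stepError n L τ ρbar hα2 hαρ2).mul_right _)] with ω ⟨⟨r, hr⟩, hsum⟩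
  refine ⟨⟨√(r - 1), ?_⟩, (summable_mul_left_iff (by positivity)).1 hsum⟩
  simpa [dist_eq_norm, map_sub] using (hr.sub_const 1).sqrt

end Convergence

section Opial

variable {d n : ℕ} {A : Fin n → Vec d → Set (Vec d)} {B : Vec d → Vec d} {τ : ℝ}
  {α ρ : ℕ → ℝ} {ε e z : ℕ → Vec d} {w x y : ℕ → Fin (n + 1) → Vec d}

theorem IsRun.exists_tendsto_mem_extendedSolutionSet (h : IsRun A B τ α ρ ε e z w x y)
    (hτ : τ ≠ 0) (hA : ∀ i, IsMaximalMonotone (A i)) (hB : Continuous B)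
    (hαρ : ∀ k, 0 ≤ α k * ρ k) (hdiv : ¬ Summable fun k => α k * ρ k)
    (hres : Summable fun k => α k * ρ k * residual B (z k) (w k) (y k))
    {D : Set (Vec d × (Fin (n + 1) → Vec d))} (hD : D.Nonempty)
    (hclosure : extendedSolutionSet A B ⊆ closure D)
    (hdist : ∀ q ∈ D, ∃ r, Tendsto (fun k => dist (toL2 (z k, w k)) (toL2 q)) atTop (𝓝 r)) :
    ∃ p ∈ extendedSolutionSet A B, Tendsto (fun k => (z k, w k)) atTop (𝓝 p) := by
  have hbdd : Bornology.IsBounded (Set.range fun k => (z k, w k)) := by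
    obtain ⟨q, hq⟩ := hD
    obtain ⟨r, hr⟩ := hdist q hq
    obtain ⟨R, hR⟩ := hr.bddAbove_range
    refine ((toL2.symm.lipschitz.isBounded_image
      (Metric.isBounded_closedBall (x := toL2 q) (r := R))).subset ?_)
    rintro _ ⟨k, rfl⟩
    exact ⟨toL2 (z k, w k), hR ⟨k, rfl⟩, toL2.symm_apply_apply _⟩
  obtain ⟨p, hp, hcluster⟩ :=
    h.exists_mem_extendedSolutionSet_mapClusterPt hτ hA hB hαρ hdiv hres hbdd
  refine ⟨p, hp, (toL2.toHomeomorph.isInducing.tendsto_nhds_iff).2 <|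
    tendsto_of_mapClusterPt_of_tendsto_dist (D := toL2 '' D) ?_ (Set.forall_mem_image.2 hdist)
      (hcluster.continuousAt_comp toL2.continuous.continuousAt)⟩
  exact image_closure_subset_closure_image toL2.continuous ⟨p, hclosure hp, rfl⟩

end Opial

end SPS

theorem theorem1 {d n : ℕ} {Ω : Type*} [MeasurableSpace Ω] (μ : Measure Ω)
    [IsProbabilityMeasure μ]
    (A : Fin n → SPS.Vec d → Set (SPS.Vec d)) (B : SPS.Vec d → SPS.Vec d) (L : ℝ≥0)
    (hA : ∀ i, SPS.IsMaximalMonotone (A i))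
    (hBmono : ∀ u v : SPS.Vec d, 0 ≤ inner ℝ (B u - B v) (u - v))
    (hBlip : LipschitzWith L B)
    (hsol : ∃ z : SPS.Vec d, SPS.IsSolution A B z)
    (τ : ℝ) (hτ : 0 < τ)
    (α ρ : ℕ → ℝ) (hα : ∀ k, 0 ≤ α k) (hρ : ∀ k, 0 ≤ ρ k)
    (hαρ : Tendsto (fun K : ℕ => ∑ k ∈ Finset.range K, α k * ρ k) atTop atTop)
    (hα2 : Summable fun k => α k ^ 2)
    (hαρ2 : Summable fun k => α k * ρ k ^ 2)
    (ρbar : ℝ) (hρbar : ∀ k, ρ k ≤ ρbar) (hρbarL : ρbar * (L : ℝ) < 1)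
    (ε e : ℕ → Ω → SPS.Vec d) (z : ℕ → Ω → SPS.Vec d)
    (w x y : ℕ → Ω → Fin (n + 1) → SPS.Vec d)
    (hz0 : Measurable (z 0)) (hw0 : Measurable (w 0))
    (hεmeas : ∀ k, Measurable (ε k)) (hemeas : ∀ k, Measurable (e k))
    (hrun : ∀ ω, SPS.IsRun A B τ α ρ (fun k => ε k ω) (fun k => e k ω)
      (fun k => z k ω) (fun k => w k ω) (fun k => x k ω) (fun k => y k ω))
    (hεint : ∀ k, Integrable (ε k) μ) (heint : ∀ k, Integrable (e k) μ)
    (hεmean : ∀ k, μ[ε k | SPS.pastSigma z w k] =ᵐ[μ] 0)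
    (hemean : ∀ k, μ[e k | SPS.pastSigma z w k] =ᵐ[μ] 0)
    (N₁ N₂ N₃ N₄ : ℝ) (hN₁ : 0 ≤ N₁) (hN₂ : 0 ≤ N₂) (hN₃ : 0 ≤ N₃) (hN₄ : 0 ≤ N₄)
    (hεvar : ∀ k, ∀ᵐ ω ∂μ,
      condLExp (SPS.pastSigma z w k) μ (fun ω' => ‖ε k ω'‖ₑ ^ 2) ω
        ≤ ENNReal.ofReal (N₁ + N₂ * ‖B (z k ω)‖ ^ 2))
    (hevar : ∀ k, ∀ᵐ ω ∂μ,
      condLExp (SPS.pastSigma z w k ⊔ SPS.noiseSigma (ε k)) μ (fun ω' => ‖e k ω'‖ₑ ^ 2) ω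
        ≤ ENNReal.ofReal (N₃ + N₄ * ‖B (x k ω (Fin.last n))‖ ^ 2)) :
    ∀ᵐ ω ∂μ,
      (∃ zstar : SPS.Vec d, SPS.IsSolution A B zstar ∧
        Tendsto (fun k => z k ω) atTop (𝓝 zstar)) ∧
      (∃ pstar ∈ SPS.extendedSolutionSet A B,
        Tendsto (fun k => (z k ω, w k ω)) atTop (𝓝 pstar)) := by
  have hrandom : SPS.IsRandomRun A B τ α ρ ε e z w x y :=
    ⟨hrun, hz0.prodMk hw0, hεmeas, hemeas⟩
  have hdiv : ¬ Summable fun k => α k * ρ k :=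
    (not_summable_iff_tendsto_nat_atTop_of_nonneg fun k => mul_nonneg (hα k) (hρ k)).2 hαρ
  obtain ⟨D, hDsub, hDcount, hclosure⟩ := (TopologicalSpace.IsSeparable.of_separableSpace
    (SPS.extendedSolutionSet A B)).exists_countable_dense_subset
  have hDne : D.Nonempty := by
    obtain ⟨z₀, hz₀⟩ := hsol
    obtain ⟨w₀, hw₀⟩ := SPS.exists_mem_extendedSolutionSet hz₀
    exact closure_nonempty_iff.1 ⟨_, hclosure hw₀⟩
  have hfejer := (ae_ball_iff hDcount).2 fun q hq =>
    SPS.ae_exists_tendsto_norm_toL2_sub_and_summable_residual hrandom hτ (fun i => (hA i).1) hBlip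
      hBmono hα hρ hα2 hαρ2 hρbar hρbarL hN₁ hN₂ hN₃ hN₄
      (fun k => ⟨hεint k, hεmean k, hεvar k⟩) (fun k => ⟨heint k, hemean k, hevar k⟩) (hDsub hq)
  filter_upwards [hfejer] with ω hω
  obtain ⟨q, hq⟩ := hDne
  obtain ⟨p, hp, hlim⟩ := (hrun ω).exists_tendsto_mem_extendedSolutionSet hτ.ne' hA
    hBlip.continuous (fun k => mul_nonneg (hα k) (hρ k)) hdiv (hω q hq).2 ⟨q, hq⟩ hclosure
    fun q hq => (hω q hq).1
  exact ⟨⟨p.1, SPS.isSolution_of_mem_extendedSolutionSet hp, hlim.fst_nhds⟩, p, hp, hlim⟩
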